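/- Let $n\ge 1$ and let $A$ be any deterministic one-dimensional cellular automaton with state set $\{0,\dots,n-1\}$, cells indexed by $\mathbb Z$ and local rule $A(u,s,v)$ giving the new state of a cell in state $s$ with left neighbour in state $u$ and right neighbour in state $v$. Consider the heptagrid (the tiling $\{7,3\}$ of the hyperbolic plane) and the dodecagrid (the tiling $\{5,3,4\}$ of hyperbolic $3$-space by right-angled dodecahedra). A cellular automaton on such a grid has a local rule giving the new state of a cell from its state and the states of its $m$ neighbours ($m=7$, resp. $m=12$), numbered by the sides, resp. faces, of the cell through which they are seen, compatibly with the orientation; it is rotation invariant if two contexts that differ by an orientation-preserving motion of the tile give the same new state. In each grid fix the following bi-infinite line of cells $(C_k)_{k\in\mathbb Z}$, the yellow line. In the heptagrid, the line through the mid-points of two contiguous sides of a fixed heptagon is the guideline, and the $C_k$ are the images of that heptagon under the powers of the shift along the guideline (the product of the half-turns about these two mid-points). In the dodecagrid, number the faces of a fixed dodecahedron by $0,\dots,11$ so that the faces around $0,1,\dots,11$, clockwise seen from outside, are respectively $15432$, $02765$, $03871$, $04982$, $0\,5\,10\,9\,3$, $0\,1\,6\,10\,4$, $1\,7\,11\,10\,5$,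 $1\,2\,8\,11\,6$, $2\,3\,9\,11\,7$, $3\,4\,10\,11\,8$, $4\,5\,6\,11\,9$, $6\,7\,8\,9\,10$; the guideline supports the edge common to the faces $0$ and $5$, and the $C_k$ are the images of the dodecahedron, with the numbering of its faces, under the powers of the shift along the guideline that carries its face $1$ to its face $4$. In both grids the $C_k$ are pairwise distinct and $C_k$ has $C_{k-1}$ and $C_{k+1}$ among its neighbours, seen through its sides $\ell$ and $r$, which do not depend on $k$ ($\ell=1$, $r=4$ in the dodecagrid). For a set $D$ of side numbers different from $\ell,r$, call red the cells seen from some $C_k$ through a side with number in $D$, and for $x:\mathbb Z\to\{0,\dots,n-1\}$ let $E_D(x)$ be the configuration with state $x_k$ in $C_k$ for each $k$, state $1$ in the red cells and state $0$ in all the other cells (if $n=1$, both $0$ and $1$ denote the only state). Then in the heptagrid there is a set $D$, and in the dodecagrid for $D=\{0,3,9,10\}$, such that the following hold, with $D$ independent of $n$ and $A$. (i) There is an algorithm (a computable function) which, given $n$ and any table of transitions of any automaton $A$ as above, returns a table of transitions of a rotation-invariant deterministic cellular automaton $B$ on the grid, with the same $n$ states, that simulates $A$ on the line: for every $x$ and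 every $t\ge 0$, after $t$ steps of $B$ the configuration $E_D(x)$ has become $E_D(A^t x)$, where $A^t x$ is the configuration of $A$ reached from $x$ after $t$ steps. (ii) If $n\ge 2$, then for every $x$, a cell with an orientation-compatible numbering of its sides sees in $E_D(x)$ the state $1$ through all its sides with number in $D$ and the state $0$ through all its sides with number not in $D\cup\{\ell,r\}$ if and only if it is one of the $C_k$ with its numbering transported by the shift. (iii) In the dodecagrid, each $C_k$ has exactly four red neighbours, and every cell not on the line has at most two red neighbours. (Here "red" refers to the set of cells defined above; a cell of the line whose state is $1$ is not counted.) -/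

import Mathlib

/-! ## One-dimensional cellular automata -/

/-- The global map of the deterministic cellular automaton on the bi-infinite line `ℤ` with
local rule `A`: `A u s v` is the new state of a cell in state `s` whose left-hand neighbour is in
state `u` and whose right-hand neighbour is in state `v`. -/
def lineStep {S : Type} (A : S → S → S → S) (x : ℤ → S) : ℤ → S :=
  fun k => A (x (k - 1)) (x k) (x (k + 1))

/-- The finite list `L` of words is a table of transitions of the one-dimensional automaton `A`:
its words are exactly the rules `u s v → s'`. -/
def IsLineTable {n : ℕ} (A : Fin n → Fin n → Fin n → Fin n) (L : List (List ℕ)) : Prop :=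
  ∀ w : List ℕ, w ∈ L ↔
    ∃ u s v : Fin n, w = [(u : ℕ), (s : ℕ), (v : ℕ), (A u s v : ℕ)]

/-! ## Cellular automata on a tiling whose tiles have `m` sides (faces) -/

/-- A tiling of an oriented space by tiles with `m` sides (faces).  A frame is a tile together
with a numbering of its sides by `Fin m` which agrees with the orientation; `nbr F i` is the tile
that `tile F` sees through its side number `i`; `rotations` is the group of renumberings of the
sides that come from the positive motions preserving a tile. -/
structure TileGrid (m : ℕ) where
  Tile : Type
  Frame : Type
  tile : Frame → Tile
  nbr : Frame → Fin m → Tile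
  rotations : Set (Equiv.Perm (Fin m))

/-- A local rule (current state, states of the `m` numbered neighbours) is rotation invariant
if contexts that are rotated forms of each other always produce the same new state. -/
def TileGrid.RotationInvariant {m : ℕ} (G : TileGrid m) {S : Type}
    (B : S → (Fin m → S) → S) : Prop :=
  ∀ μ ∈ G.rotations, ∀ (s : S) (η : Fin m → S), B s (fun i => η (μ i)) = B s η

/-- A choice, for every tile, of a numbering of its sides. -/
def TileGrid.IsNumbering {m : ℕ} (G : TileGrid m) (ν : G.Tile → G.Frame) : Prop :=
  ∀ T, G.tile (ν T) = T

/-- The global map of the cellular automaton with local rule `B`, the sides of every tile being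
numbered by `ν`. -/
def TileGrid.step {m : ℕ} (G : TileGrid m) (ν : G.Tile → G.Frame) {S : Type}
    (B : S → (Fin m → S) → S) (c : G.Tile → S) : G.Tile → S :=
  fun T => B (c T) (fun i => c (G.nbr (ν T) i))

/-- The finite list `L` of words is a table of transitions of `B`: its words are exactly the
rules `s η₀ ⋯ η₍ₘ₋₁₎ s'`. -/
def IsGridTable {n m : ℕ} (B : Fin n → (Fin m → Fin n) → Fin n) (L : List (List ℕ)) : Prop :=
  ∀ w : List ℕ, w ∈ L ↔
    ∃ (s : Fin n) (η : Fin m → Fin n),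
      w = (s : ℕ) :: (List.ofFn (fun i => (η i : ℕ)) ++ [(B s η : ℕ)])

/-! ## Lines of tiles -/

/-- A bi-infinite sequence of framed tiles of the grid `G`; `left` and `right` are the numbers of
the sides which the tile number `k` shares with the tiles number `k - 1` and `k + 1`. -/
structure TileLine {m : ℕ} (G : TileGrid m) where
  frame : ℤ → G.Frame
  left : Fin m
  right : Fin m

namespace TileLine

variable {m : ℕ} {G : TileGrid m}

/-- The `k`-th tile of the line. -/
def cell (l : TileLine G) (k : ℤ) : G.Tile := G.tile (l.frame k)

/-- The tiles are pairwise distinct, and each one is followed by its neighbour through the side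
`right` and preceded by its neighbour through the side `left`. -/
def IsLine (l : TileLine G) : Prop :=
  Function.Injective l.cell ∧
    ∀ k, G.nbr (l.frame k) l.right = l.cell (k + 1) ∧ G.nbr (l.frame k) l.left = l.cell (k - 1)

/-- The red cells: those which some cell of the line sees through a side whose number is
in `D`. -/
def red (l : TileLine G) (D : Finset (Fin m)) : Set G.Tile :=
  {T | ∃ k, ∃ i ∈ D, G.nbr (l.frame k) i = T}

open Classical in
/-- The configuration which carries the one-dimensional configuration `x` on the line and, off the
line, the state `1` on the red cells and the state `0` on all the other cells. -/
noncomputable def embed (l : TileLine G) (D : Finset (Fin m)) {n : ℕ} [NeZero n]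
    (x : ℤ → Fin n) : G.Tile → Fin n :=
  Function.extend l.cell x (fun T => if T ∈ l.red D then 1 else 0)

/-- In the configuration `c`, the tile of `F`, numbered by `F`, sees the state `1` through all sides
with number in `D` and the state `0` through all the others, the sides `left` and `right` being
disregarded. -/
def SeesPattern (l : TileLine G) (D : Finset (Fin m)) {n : ℕ} [NeZero n]
    (c : G.Tile → Fin n) (F : G.Frame) : Prop :=
  ∀ i, i ≠ l.left → i ≠ l.right → c (G.nbr F i) = if i ∈ D then 1 else 0

/-- As soon as the states `0` and `1` are distinct, whatever the states on the line, the pattern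
given by `D` is seen from the cells of the line and from no other cell, and from a cell of the line
only in the numbering for which `left` and `right` are its neighbours on the line. -/
def PatternCharacterizes (l : TileLine G) (D : Finset (Fin m)) : Prop :=
  ∀ (n : ℕ) [NeZero n], 2 ≤ n → ∀ (x : ℤ → Fin n) (F : G.Frame),
    l.SeesPattern D (l.embed D x) F ↔ ∃ k, F = l.frame k

/-- The automaton `B` on the grid simulates the one-dimensional automaton `A` on the line,
step by step, whatever the initial configuration of `A` and the numberings of the tiles. -/
def Simulates (l : TileLine G) (D : Finset (Fin m)) {n : ℕ} [NeZero n]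
    (B : Fin n → (Fin m → Fin n) → Fin n) (A : Fin n → Fin n → Fin n → Fin n) : Prop :=
  ∀ ν : G.Tile → G.Frame, G.IsNumbering ν → ∀ (x : ℤ → Fin n) (t : ℕ),
    (G.step ν B)^[t] (l.embed D x) = l.embed D ((lineStep A)^[t] x)

/-- `f` is an algorithm which, given the number of states and any table of transitions of any
one-dimensional automaton `A`, returns a table of transitions of a rotation-invariant automaton
on the grid which has the same states and simulates `A` on the line. -/
def IsSimulationAlgorithm (l : TileLine G) (D : Finset (Fin m))
    (f : ℕ × List (List ℕ) → List (List ℕ)) : Prop :=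
  Computable f ∧
    ∀ (n : ℕ) [NeZero n] (A : Fin n → Fin n → Fin n → Fin n) (L : List (List ℕ)),
      IsLineTable A L →
        ∃ B : Fin n → (Fin m → Fin n) → Fin n,
          IsGridTable B (f (n, L)) ∧ G.RotationInvariant B ∧ l.Simulates D B A

/-- The red neighbours of the tile of `F`. -/
def redNeighbours (l : TileLine G) (D : Finset (Fin m)) (F : G.Frame) : Set G.Tile :=
  {T | T ∈ l.red D ∧ ∃ i, G.nbr F i = T}

end TileLine

/-! ## The heptagrid `{7,3}` -/

/-- The defining relations `a⁷ = b² = (ab)³ = 1` of the rotation group of the tiling `{7,3}`: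
`a` (the generator `0`) is the rotation by `2π/7` about the centre of a fixed heptagon, `b` (the
generator `1`) is the half-turn about the mid-point of its side number `0`, and `ab` is a rotation
by `2π/3` about a vertex. -/
def triangleRelations : Set (FreeGroup (Fin 2)) :=
  {FreeGroup.of 0 ^ 7, FreeGroup.of 1 ^ 2, (FreeGroup.of 0 * FreeGroup.of 1) ^ 3}

/-- The group of the orientation-preserving symmetries of the tiling `{7,3}` (the triangle group
`(2,3,7)`).  It acts simply transitively on the pairs (heptagon, side of it). -/
abbrev TriangleGroup : Type := PresentedGroup triangleRelations

/-- The rotation about the centre of the base heptagon. -/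
def heptaRot : TriangleGroup := PresentedGroup.of 0

/-- The half-turn about the mid-point of the side number `0` of the base heptagon. -/
def heptaHalf : TriangleGroup := PresentedGroup.of 1

/-- The heptagrid.  The tiles are the images `g P` of the base heptagon `P`, that is the cosets
modulo the stabilizer of `P`; the frame `g` is the tile `g P` with the sides numbered by transport
of the numbering of `P`, turning around `P`; the neighbour of `P` through its side `i` is
`aⁱ b P`. -/
def heptagrid : TileGrid 7 where
  Tile := TriangleGroup ⧸ Subgroup.zpowers heptaRot
  Frame := TriangleGroup
  tile g := (g : TriangleGroup ⧸ Subgroup.zpowers heptaRot)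
  nbr g i := ((g * heptaRot ^ (i : ℕ) * heptaHalf : TriangleGroup) :
    TriangleGroup ⧸ Subgroup.zpowers heptaRot)
  rotations := {μ | ∃ k : Fin 7, ∀ i, μ i = i + k}

/-- The half-turn about the mid-point of the side number `i` of the base heptagon. -/
def heptaSideHalf (i : ℕ) : TriangleGroup := heptaRot ^ i * heptaHalf * (heptaRot ^ i)⁻¹

/-- The shift along the mid-point line through the mid-points of the contiguous sides `1` and `2`
of the base heptagon: the product of the half-turns about these two points. -/
def heptaShift : TriangleGroup := heptaSideHalf 1 * heptaSideHalf 2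

/-- The line of the heptagrid generated from the base heptagon by the shift along the guideline. -/
def heptaLine : TileLine heptagrid where
  frame k := heptaShift ^ k
  left := (3 : Fin 7)
  right := (0 : Fin 7)

/-! ## The dodecagrid `{5,3,4}` -/

/-- The faces of the dodecahedron around a given face, in clockwise order when looking at the face
from outside. -/
def facesAround : Fin 12 → Fin 5 → Fin 12 :=
  ![![1, 5, 4, 3, 2], ![0, 2, 7, 6, 5], ![0, 3, 8, 7, 1], ![0, 4, 9, 8, 2],
    ![0, 5, 10, 9, 3], ![0, 1, 6, 10, 4], ![1, 7, 11, 10, 5], ![1, 2, 8, 11, 6],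
    ![2, 3, 9, 11, 7], ![3, 4, 10, 11, 8], ![4, 5, 6, 11, 9], ![6, 7, 8, 9, 10]]

/-- Two faces of the dodecahedron share an edge. -/
def FacesAdjacent (f g : Fin 12) : Prop := ∃ j, facesAround f j = g

instance (f g : Fin 12) : Decidable (FacesAdjacent f g) :=
  inferInstanceAs (Decidable (∃ j, facesAround f j = g))

/-- The permutation of the faces induced by a positive motion preserving the dodecahedron. -/
def IsPositiveMotion (μ : Equiv.Perm (Fin 12)) : Prop :=
  ∀ f, ∃ k : Fin 5, ∀ j, facesAround (μ f) (k + j) = μ (facesAround f j)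

/-- The permutation of the faces induced by an orientation-reversing isometry preserving the
dodecahedron. -/
def IsNegativeMotion (μ : Equiv.Perm (Fin 12)) : Prop :=
  ∀ f, ∃ k : Fin 5, ∀ j, facesAround (μ f) (k - j) = μ (facesAround f j)

instance (μ : Equiv.Perm (Fin 12)) : Decidable (IsPositiveMotion μ) :=
  inferInstanceAs (Decidable (∀ f, ∃ k : Fin 5, ∀ j, facesAround (μ f) (k + j) = _))

instance (μ : Equiv.Perm (Fin 12)) : Decidable (IsNegativeMotion μ) :=
  inferInstanceAs (Decidable (∀ f, ∃ k : Fin 5, ∀ j, facesAround (μ f) (k - j) = _))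

/-- The Coxeter matrix of the group generated by the reflections in the planes of the faces of the
right-angled dodecahedron: the reflections in two faces sharing an edge commute, those in two other
distinct faces generate an infinite dihedral group (entry `0`, the convention for `∞`). -/
def dodecaCoxeter : CoxeterMatrix (Fin 12) where
  M := Matrix.of fun f g => if f = g then 1 else if FacesAdjacent f g then 2 else 0
  isSymm := by decide
  diagonal := by decide
  off_diagonal f g h := by
    rw [Matrix.of_apply, if_neg h]
    split <;> decide

/-- The group generated by the reflections in the faces of the right-angled dodecahedron `P`.  It
acts simply transitively on the tiles of `{5,3,4}`, so that the tiles are the `w P`, `w` in the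
group. -/
abbrev DodecaGroup : Type := dodecaCoxeter.Group

/-- The reflection in the face `f` of the base dodecahedron. -/
def dodecaRefl (f : Fin 12) : DodecaGroup := dodecaCoxeter.simple f

/-- The element `w` preserves the orientation. -/
def DodecaEven (w : DodecaGroup) : Prop := Even (dodecaCoxeter.toCoxeterSystem.length w)

/-- The dodecagrid.  The tile `w` stands for `w P`, and `w * dodecaRefl f` is its reflection in its
face `w f`.  The numbering `ρ` gives the number `i` to the face `w (ρ i)`; it agrees with the
orientation when `w` and `ρ` both preserve or both reverse the orientation. -/
def dodecagrid : TileGrid 12 where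
  Tile := DodecaGroup
  Frame := {p : DodecaGroup × Equiv.Perm (Fin 12) //
    (DodecaEven p.1 ∧ IsPositiveMotion p.2) ∨ (¬ DodecaEven p.1 ∧ IsNegativeMotion p.2)}
  tile F := F.1.1
  nbr F i := F.1.1 * dodecaRefl (F.1.2 i)
  rotations := {μ | IsPositiveMotion μ}

/-- The reflection of the dodecahedron which exchanges the faces `1` and `4` and preserves the
faces `0` and `5`. -/
def dodecaMirror : Equiv.Perm (Fin 12) :=
  Equiv.swap 1 4 * Equiv.swap 2 3 * Equiv.swap 6 10 * Equiv.swap 7 9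

/-- The tile number `k` of the line: successive tiles are reflections of each other in the planes,
perpendicular to the guideline, of alternately the faces `4` and `1` of the base dodecahedron. -/
def dodecaLineTile (k : ℤ) : DodecaGroup :=
  (dodecaRefl 4 * dodecaRefl 1) ^ (k / 2) * (if Even k then 1 else dodecaRefl 4)

/-- The numbering of the faces of the tile number `k` of the line, transported from the base
dodecahedron by the shift along the guideline. -/
def dodecaLineNumbering (k : ℤ) : Equiv.Perm (Fin 12) :=
  if Even k then 1 else dodecaMirror

theorem dodecaEven_lineTile (k : ℤ) : DodecaEven (dodecaLineTile k) ↔ Even k := by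
  have key : ∀ w : DodecaGroup, DodecaEven w ↔
      dodecaCoxeter.toCoxeterSystem.lengthParity w = 1 := by
    intro w
    rw [DodecaEven, CoxeterSystem.lengthParity_eq_ofAdd_length, ← ZMod.natCast_eq_zero_iff_even,
      ← ofAdd_zero, Multiplicative.ofAdd.apply_eq_iff_eq]
  have hs : ∀ f, dodecaCoxeter.toCoxeterSystem.lengthParity (dodecaRefl f) =
      Multiplicative.ofAdd 1 := fun f =>
    dodecaCoxeter.toCoxeterSystem.lengthParity_simple f
  have h1 : (Multiplicative.ofAdd (1 : ZMod 2)) * Multiplicative.ofAdd 1 = 1 := by decide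
  have h2 : (Multiplicative.ofAdd (1 : ZMod 2)) ≠ 1 := by decide
  rw [key, dodecaLineTile, map_mul, map_zpow, map_mul, hs, hs, h1, one_zpow, one_mul]
  by_cases hk : Even k
  · simp [hk]
  · simp [hk, hs, h2]

/-- The line of the dodecagrid: the base dodecahedron stands on the reference plane by its face `0`,
the guideline supports the edge common to its faces `0` and `5`, and the line is generated by the
shift along the guideline. -/
def dodecaLine : TileLine dodecagrid where
  frame k := ⟨(dodecaLineTile k, dodecaLineNumbering k), by
    by_cases hk : Even k
    · refine Or.inl ⟨(dodecaEven_lineTile k).2 hk, ?_⟩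
      simp only [dodecaLineNumbering, if_pos hk]
      decide
    · refine Or.inr ⟨fun h => hk ((dodecaEven_lineTile k).1 h), ?_⟩
      simp only [dodecaLineNumbering, if_neg hk]
      decide⟩
  left := (1 : Fin 12)
  right := (4 : Fin 12)

/-- The numbers of the faces through which the cells of the line see a red cell. -/
def dodecaRedFaces : Finset (Fin 12) := {0, 3, 9, 10}

/-! ## Primitive recursive auxiliaries -/

/-! The lifted rule applies `A` to the contexts which show the pattern `D` after some rotation, and
keeps the state in all the others. Once the pattern is visible from the cells of the line only, and
in one numbering only, this rule is well defined, rotation invariant and simulates `A`: line cells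
compute `A`, all other cells are frozen. Its table is obtained by filtering the finitely many
candidate words with a primitive recursive test, which gives the algorithm
(`TileLine.isSimulationAlgorithm_liftTable`). What remains is geometry: in each grid, the line is a
line and `PatternCharacterizes` holds. A line cell can show any state, so a side in `D` that shows
`1` leads to a red cell or to a line cell.

In the dodecagrid, tiles are elements of a right-angled Coxeter group. The parity of the number of
reflections in a face is a homomorphism to `ZMod 2`; line tiles are words in the reflections `1` and
`4`, so all their other parities vanish. Comparing parities shows that a cell off the line has at
most two red neighbours (`exists_two_red_faces`) and at most one neighbour on the line
(`exists_line_face`): three faces cannot play the role of the four in `D`. On the line, a finite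
check leaves only the identity among the rotations compatible with the pattern
(`IsPositiveMotion.eq_one_of_redFaces`).

In the heptagrid, `D = {1, 2, 5}`. The triangle group acts on covectors of a three-dimensional
space, with `c = 2 cos (2π/7)`. Over `ℝ` this shows that the shift has infinite order. Modulo `13`,
with `c = 10`, the signed height above the guideline is a shift-invariant function on tiles with
finitely many values, and `decide` separates the line from its surroundings. -/

theorem PrimrecPred.exists_finite {ι α : Type*} [Finite ι] [Primcodable α] {P : ι → α → Prop}
    (hP : ∀ i, PrimrecPred (P i)) : PrimrecPred fun a => ∃ i, P i a := by
  classical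
  have := Fintype.ofFinite ι
  have key : ∀ s : Finset ι, PrimrecPred fun a => ∃ i ∈ s, P i a := by
    intro s
    induction s using Finset.induction_on with
    | empty => exact (Primrec.primrecPred (p := fun _ : α => False) (by
        simpa using Primrec.const false)).of_eq (by simp)
    | insert i s _ ih => exact ((hP i).or ih).of_eq (by simp)
  exact (key Finset.univ).of_eq (by simp)

theorem PrimrecPred.forall_finite {ι α : Type*} [Finite ι] [Primcodable α] {P : ι → α → Prop}
    (hP : ∀ i, PrimrecPred (P i)) : PrimrecPred fun a => ∀ i, P i a :=
  (PrimrecPred.exists_finite fun i => (hP i).not).not.of_eq (by simp)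

/-- The truth value is a constant, so deciding it classically costs no computability. This absorbs
conditions on the fixed data `G`, `l`, `D`. -/
theorem PrimrecPred.const_prop {α : Type*} [Primcodable α] (p : Prop) :
    PrimrecPred fun _ : α => p := by
  classical
  exact Primrec.primrecPred (Primrec.const (decide p))

theorem PrimrecPred.imp {α : Type*} [Primcodable α] {p q : α → Prop} (hp : PrimrecPred p)
    (hq : PrimrecPred q) : PrimrecPred fun a => p a → q a :=
  (hp.not.or hq).of_eq fun _ => imp_iff_not_or.symm

/-- The words of length `k` over the alphabet `{0, …, n - 1}`. -/
def wordsOfLength (n : ℕ) : ℕ → List (List ℕ)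
  | 0 => [[]]
  | k + 1 => (wordsOfLength n k).flatMap fun w => (List.range n).map fun a => a :: w

theorem mem_wordsOfLength {n k : ℕ} {w : List ℕ} :
    w ∈ wordsOfLength n k ↔ w.length = k ∧ ∀ a ∈ w, a < n := by
  induction k generalizing w with
  | zero =>
    rw [wordsOfLength, List.mem_singleton, List.length_eq_zero_iff]
    exact ⟨by rintro rfl; simp, fun h => h.1⟩
  | succ k ih =>
    rw [wordsOfLength, List.mem_flatMap]
    constructor
    · rintro ⟨v, hv, hw⟩
      obtain ⟨a, ha, rfl⟩ := List.mem_map.1 hw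
      have := ih.1 hv
      simp only [List.length_cons, this.1, List.mem_cons, true_and]
      rintro b (rfl | hb)
      · exact List.mem_range.1 ha
      · exact this.2 b hb
    · rintro ⟨hl, hw⟩
      cases w with
      | nil => simp at hl
      | cons a v =>
        exact ⟨v, ih.2 ⟨by simpa using hl, fun b hb => hw b (List.mem_cons_of_mem _ hb)⟩,
          List.mem_map.2 ⟨a, List.mem_range.2 (hw a List.mem_cons_self), rfl⟩⟩

theorem primrec_wordsOfLength (k : ℕ) : Primrec fun n => wordsOfLength n k := by
  induction k with
  | zero => exact Primrec.const _
  | succ k ih =>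
    refine Primrec.list_flatMap ih (Primrec.list_map (Primrec.list_range.comp Primrec.fst) ?_)
    exact Primrec.list_cons.comp Primrec.snd (Primrec.snd.comp Primrec.fst)

theorem getD_ruleWord_state {m : ℕ} (s s' : ℕ) (η : Fin m → ℕ) :
    (s :: (List.ofFn η ++ [s'])).getD 0 0 = s := rfl

theorem getD_ruleWord_neighbour {m : ℕ} (s s' : ℕ) (η : Fin m → ℕ) (i : Fin m) :
    (s :: (List.ofFn η ++ [s'])).getD (i + 1) 0 = η i := by
  simp

theorem getD_ruleWord_newState {m : ℕ} (s s' : ℕ) (η : Fin m → ℕ) :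
    (s :: (List.ofFn η ++ [s'])).getD (m + 1) 0 = s' := by
  simp

theorem mem_wordsOfLength_iff_ruleWord {n m : ℕ} {w : List ℕ} :
    w ∈ wordsOfLength n (m + 2) ↔ ∃ (s : Fin n) (η : Fin m → Fin n) (s' : Fin n),
      w = (s : ℕ) :: (List.ofFn (fun i => (η i : ℕ)) ++ [(s' : ℕ)]) := by
  rw [mem_wordsOfLength]
  constructor
  · rintro ⟨hl, hw⟩
    cases w with
    | nil => simp at hl
    | cons s v =>
      have hv : v.length = m + 1 := by simpa using hl
      have hne : v ≠ [] := by rintro rfl; simp at hv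
      have hlen : v.dropLast.length = m := by simp [hv]
      refine ⟨⟨s, hw s List.mem_cons_self⟩,
        fun i => ⟨v.dropLast[(i : ℕ)]'(by omega), hw _ (List.mem_cons_of_mem _
          (List.mem_of_mem_dropLast (List.getElem_mem _)))⟩,
        ⟨v.getLast hne, hw _ (List.mem_cons_of_mem _ (List.getLast_mem hne))⟩, ?_⟩
      congr 1
      conv_lhs => rw [← List.dropLast_append_getLast hne]
      congr 1
      apply List.ext_getElem
      · simp [hv]
      · intro i h1 h2
        simp
  · rintro ⟨s, η, s', rfl⟩
    refine ⟨by simp, ?_⟩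
    intro a ha
    simp only [List.mem_cons, List.mem_append, List.mem_ofFn, List.not_mem_nil, or_false] at ha
    rcases ha with rfl | ⟨i, rfl⟩ | rfl
    · exact s.2
    · exact (η i).2
    · exact s'.2

/-! ## Simulation on a line which is characterized by a pattern -/

/-- The numberings of a tile are exactly the images of any of them under the group of rotations. -/
structure TileGrid.Regular {m : ℕ} (G : TileGrid m) : Prop where
  mul_mem : ∀ μ ∈ G.rotations, ∀ μ' ∈ G.rotations, μ * μ' ∈ G.rotations
  inv_mem : ∀ μ ∈ G.rotations, μ⁻¹ ∈ G.rotations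
  exists_rotation : ∀ F F', G.tile F = G.tile F' →
    ∃ μ ∈ G.rotations, ∀ i, G.nbr F' i = G.nbr F (μ i)
  exists_frame : ∀ F, ∀ μ ∈ G.rotations,
    ∃ F', G.tile F' = G.tile F ∧ ∀ i, G.nbr F' i = G.nbr F (μ i)

namespace TileLine

variable {m : ℕ} {G : TileGrid m} (l : TileLine G) (D : Finset (Fin m))

/-- The context `η`, turned by `μ`, shows the pattern `D`. -/
def Matches {n : ℕ} [NeZero n] (η : Fin m → Fin n) (μ : Equiv.Perm (Fin m)) : Prop :=
  ∀ i, i ≠ l.left → i ≠ l.right → η (μ i) = if i ∈ D then 1 else 0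

open Classical in
/-- The rule which applies the one-dimensional rule `A` in the contexts showing the pattern `D`
and changes nothing in the other contexts. -/
noncomputable def liftRule {n : ℕ} [NeZero n] (A : Fin n → Fin n → Fin n → Fin n)
    (s : Fin n) (η : Fin m → Fin n) : Fin n :=
  if h : ∃ μ ∈ G.rotations, l.Matches D η μ then
    A (η (h.choose l.left)) s (η (h.choose l.right))
  else s

variable {l D}

theorem embed_cell (hl : l.IsLine) {n : ℕ} [NeZero n] (x : ℤ → Fin n) (k : ℤ) :
    l.embed D x (l.cell k) = x k :=
  hl.1.extend_apply _ _ _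

open Classical in
theorem embed_of_notMem_range {n : ℕ} [NeZero n] (x : ℤ → Fin n) {T : G.Tile}
    (hT : T ∉ Set.range l.cell) : l.embed D x T = if T ∈ l.red D then 1 else 0 :=
  Function.extend_apply' _ _ _ hT

theorem fin_one_ne_zero {n : ℕ} [NeZero n] (hn : 2 ≤ n) : (1 : Fin n) ≠ 0 := by
  intro h
  have := congrArg Fin.val h
  simp [Nat.mod_eq_of_lt (show 1 < n from hn)] at this

/-- The alternative cannot be dropped: `x` is arbitrary, so a line cell may imitate a red one. -/
theorem SeesPattern.mem_red_or_mem_range {n : ℕ} [NeZero n] (hn : 2 ≤ n) {x : ℤ → Fin n}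
    {F : G.Frame} (h : l.SeesPattern D (l.embed D x) F) {i : Fin m} (hi : i ≠ l.left)
    (hi' : i ≠ l.right) (hiD : i ∈ D) : G.nbr F i ∈ l.red D ∨ G.nbr F i ∈ Set.range l.cell := by
  by_contra! hc
  have := h i hi hi'
  rw [embed_of_notMem_range x hc.2, if_neg hc.1, if_pos hiD] at this
  exact fin_one_ne_zero hn this.symm

theorem SeesPattern.notMem_red_or_mem_range {n : ℕ} [NeZero n] (hn : 2 ≤ n) {x : ℤ → Fin n}
    {F : G.Frame} (h : l.SeesPattern D (l.embed D x) F) {i : Fin m} (hi : i ≠ l.left)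
    (hi' : i ≠ l.right) (hiD : i ∉ D) : G.nbr F i ∉ l.red D ∨ G.nbr F i ∈ Set.range l.cell := by
  by_contra! hc
  have := h i hi hi'
  rw [embed_of_notMem_range x hc.2, if_pos hc.1, if_neg hiD] at this
  exact fin_one_ne_zero hn this

theorem seesPattern_frame (h : ∀ k i, i ≠ l.left → i ≠ l.right →
    G.nbr (l.frame k) i ∉ Set.range l.cell ∧ (G.nbr (l.frame k) i ∈ l.red D → i ∈ D))
    {n : ℕ} [NeZero n] (x : ℤ → Fin n) (k : ℤ) :
    l.SeesPattern D (l.embed D x) (l.frame k) := by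
  intro i hi hi'
  obtain ⟨h1, h2⟩ := h k i hi hi'
  have h3 : G.nbr (l.frame k) i ∈ l.red D ↔ i ∈ D := ⟨h2, fun hi => ⟨k, i, hi, rfl⟩⟩
  rw [embed_of_notMem_range x h1]
  simp only [h3]

/-- The abstract context `η` is realised around the cell `0` of the line. The second match then
yields a frame of that cell which sees the pattern; by hypothesis it is `l.frame 0` itself, so `μ`
and `μ'` read the same states. -/
theorem Matches.apply_eq (hG : G.Regular) (hl : l.IsLine) (hD : l.PatternCharacterizes D) {n : ℕ}
    [NeZero n] (hn : 2 ≤ n) {η : Fin m → Fin n} {μ μ' : Equiv.Perm (Fin m)}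
    (hμ : μ ∈ G.rotations) (hμ' : μ' ∈ G.rotations) (h : l.Matches D η μ)
    (h' : l.Matches D η μ') :
    η (μ' l.left) = η (μ l.left) ∧ η (μ' l.right) = η (μ l.right) := by
  -- Only the values at `-1` and `1` matter.
  set x : ℤ → Fin n := fun k => if k = 1 then η (μ l.right) else η (μ l.left) with hx
  have hc : ∀ i, l.embed D x (G.nbr (l.frame 0) i) = η (μ i) := by
    intro i
    by_cases hi : i = l.left
    · rw [hi, (hl.2 0).2, embed_cell hl]; simp [hx]
    · by_cases hi' : i = l.right
      · rw [hi', (hl.2 0).1, embed_cell hl]; simp [hx]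
      · rw [h i hi hi']
        exact (hD n hn x (l.frame 0)).2 ⟨0, rfl⟩ i hi hi'
  obtain ⟨F', hF', hnbr⟩ := hG.exists_frame (l.frame 0) (μ⁻¹ * μ')
    (hG.mul_mem _ (hG.inv_mem _ hμ) _ hμ')
  have hc' : ∀ i, l.embed D x (G.nbr F' i) = η (μ' i) := by
    intro i
    rw [hnbr, hc]
    simp
  obtain ⟨k, hk⟩ := (hD n hn x F').1 fun i hi hi' => by rw [hc', h' i hi hi']
  have hk0 : k = 0 := hl.1 (by rw [cell, ← hk, hF', cell])
  subst hk0 hk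
  simp only [← hc, ← hc', and_self]

theorem liftRule_eq (hG : G.Regular) (hl : l.IsLine) (hD : l.PatternCharacterizes D) {n : ℕ}
    [NeZero n] (A : Fin n → Fin n → Fin n → Fin n) (s : Fin n) {η : Fin m → Fin n}
    {μ : Equiv.Perm (Fin m)} (hμ : μ ∈ G.rotations) (h : l.Matches D η μ) :
    l.liftRule D A s η = A (η (μ l.left)) s (η (μ l.right)) := by
  rcases Nat.lt_or_ge n 2 with hn | hn
  · have : n = 1 := by have := NeZero.pos n; omega
    subst this
    exact Subsingleton.elim _ _
  · have hex : ∃ μ ∈ G.rotations, l.Matches D η μ := ⟨μ, hμ, h⟩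
    rw [liftRule, dif_pos hex]
    obtain ⟨e1, e2⟩ := h.apply_eq hG hl hD hn hμ hex.choose_spec.1 hex.choose_spec.2
    rw [e1, e2]

theorem liftRule_of_not_exists {n : ℕ} [NeZero n] (A : Fin n → Fin n → Fin n → Fin n) (s : Fin n)
    {η : Fin m → Fin n} (h : ¬ ∃ μ ∈ G.rotations, l.Matches D η μ) :
    l.liftRule D A s η = s :=
  dif_neg h

theorem rotationInvariant_liftRule (hG : G.Regular) (hl : l.IsLine)
    (hD : l.PatternCharacterizes D) {n : ℕ} [NeZero n] (A : Fin n → Fin n → Fin n → Fin n) :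
    G.RotationInvariant (l.liftRule D A) := by
  intro μ hμ s η
  by_cases h : ∃ μ' ∈ G.rotations, l.Matches D η μ'
  · obtain ⟨μ', hμ', h⟩ := h
    have h' : l.Matches D (fun i => η (μ i)) (μ⁻¹ * μ') := fun i hi hi' => by
      simpa using h i hi hi'
    rw [liftRule_eq hG hl hD A s hμ' h,
      liftRule_eq hG hl hD A s (hG.mul_mem _ (hG.inv_mem _ hμ) _ hμ') h']
    simp
  · rw [liftRule_of_not_exists A s h, liftRule_of_not_exists]
    rintro ⟨μ', hμ', h'⟩
    exact h ⟨μ * μ', hG.mul_mem _ hμ _ hμ', fun i hi hi' => h' i hi hi'⟩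

theorem step_liftRule_embed (hG : G.Regular) (hl : l.IsLine) (hD : l.PatternCharacterizes D)
    {n : ℕ} [NeZero n] (A : Fin n → Fin n → Fin n → Fin n) {ν : G.Tile → G.Frame}
    (hν : G.IsNumbering ν) (x : ℤ → Fin n) :
    G.step ν (l.liftRule D A) (l.embed D x) = l.embed D (lineStep A x) := by
  -- With a single state the pattern carries no information, but all configurations are equal.
  rcases Nat.lt_or_ge n 2 with hn | hn
  · have : n = 1 := by have := NeZero.pos n; omega
    subst this
    exact Subsingleton.elim _ _
  funext T
  rw [TileGrid.step]
  by_cases hT : T ∈ Set.range l.cell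
  · obtain ⟨k, rfl⟩ := hT
    obtain ⟨μ, hμ, hnbr⟩ := hG.exists_rotation (ν (l.cell k)) (l.frame k) (hν _)
    have h : l.Matches D (fun i => l.embed D x (G.nbr (ν (l.cell k)) i)) μ := fun i hi hi' => by
      beta_reduce
      rw [← hnbr]
      exact (hD n hn x (l.frame k)).2 ⟨k, rfl⟩ i hi hi'
    rw [liftRule_eq hG hl hD A _ hμ h, ← hnbr, ← hnbr, (hl.2 k).1, (hl.2 k).2]
    simp only [embed_cell hl, lineStep]
  · rw [liftRule_of_not_exists, embed_of_notMem_range _ hT, embed_of_notMem_range _ hT]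
    -- A match off the line would produce a frame there which sees the pattern.
    rintro ⟨μ, hμ, h⟩
    obtain ⟨F', hF', hnbr⟩ := hG.exists_frame (ν T) μ hμ
    obtain ⟨k, hk⟩ := (hD n hn x F').1 fun i hi hi' => by rw [hnbr, ← h i hi hi']
    exact hT ⟨k, by rw [cell, ← hk, hF', hν]⟩

theorem simulates_liftRule (hG : G.Regular) (hl : l.IsLine) (hD : l.PatternCharacterizes D)
    {n : ℕ} [NeZero n] (A : Fin n → Fin n → Fin n → Fin n) :
    l.Simulates D (l.liftRule D A) A := by
  intro ν hν x t
  induction t generalizing x with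
  | zero => rfl
  | succ t ih =>
    rw [Function.iterate_succ_apply, Function.iterate_succ_apply,
      step_liftRule_embed hG hl hD A hν, ih]

/-! ### Computability of the lifted table. -/

variable (l D)

/-- The word `w` describes a context with `n` states which, turned by `μ`, shows the pattern `D`. -/
def WordMatches (n : ℕ) (w : List ℕ) (μ : Equiv.Perm (Fin m)) : Prop :=
  ∀ i, i ≠ l.left → i ≠ l.right → w.getD (μ i + 1) 0 = if i ∈ D then 1 % n else 0

/-- The word `w` is a rule of the automaton lifted from the one-dimensional automaton with number
of states `p.1` and table `p.2`. -/
def IsLiftedRule (w : List ℕ) (p : ℕ × List (List ℕ)) : Prop :=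
  (∃ μ : Equiv.Perm (Fin m), (μ ∈ G.rotations ∧ l.WordMatches D p.1 w μ) ∧
    [w.getD (μ l.left + 1) 0, w.getD 0 0, w.getD (μ l.right + 1) 0, w.getD (m + 1) 0] ∈ p.2) ∨
  ((¬ ∃ μ : Equiv.Perm (Fin m), μ ∈ G.rotations ∧ l.WordMatches D p.1 w μ) ∧
    w.getD (m + 1) 0 = w.getD 0 0)

open Classical in
/-- The table of the automaton lifted from the one-dimensional automaton with number of states
`p.1` and table `p.2`. -/
noncomputable def liftTable (p : ℕ × List (List ℕ)) : List (List ℕ) :=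
  (wordsOfLength p.1 (m + 2)).filter fun w => l.IsLiftedRule D w p

theorem primrecRel_isLiftedRule : PrimrecRel (l.IsLiftedRule D) := by
  have hget : ∀ j, Primrec fun q : List ℕ × (ℕ × List (List ℕ)) => q.1.getD j 0 := fun j =>
    (Primrec.list_getD 0).comp Primrec.fst (Primrec.const j)
  have hn : Primrec fun q : List ℕ × (ℕ × List (List ℕ)) => q.2.1 :=
    Primrec.fst.comp Primrec.snd
  have hm : ∀ μ : Equiv.Perm (Fin m),
      PrimrecPred fun q : List ℕ × (ℕ × List (List ℕ)) =>
        μ ∈ G.rotations ∧ l.WordMatches D q.2.1 q.1 μ := by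
    intro μ
    refine (PrimrecPred.const_prop _).and (PrimrecPred.forall_finite fun i =>
      (PrimrecPred.const_prop _).imp ((PrimrecPred.const_prop _).imp
        (Primrec.eq.comp (hget _) ?_)))
    exact Primrec.ite (PrimrecPred.const_prop _) (Primrec.nat_mod.comp (Primrec.const 1) hn)
      (Primrec.const 0)
  have hmem : PrimrecRel fun (L : List (List ℕ)) (w : List ℕ) => w ∈ L :=
    (Primrec.eq (α := List ℕ)).exists_mem_list.of_eq fun L w => by simp
  refine (PrimrecPred.exists_finite fun μ => (hm μ).and ?_).or
    ((PrimrecPred.exists_finite hm).not.and (Primrec.eq.comp (hget _) (hget _)))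
  refine hmem.comp (Primrec.snd.comp Primrec.snd) ?_
  exact Primrec.list_cons.comp (hget _) (Primrec.list_cons.comp (hget _)
    (Primrec.list_cons.comp (hget _) (Primrec.list_cons.comp (hget _) (Primrec.const []))))

theorem computable_liftTable : Computable (l.liftTable D) := by
  classical
  have h : Primrec (l.liftTable D) :=
    (l.primrecRel_isLiftedRule D).listFilter.comp
      ((primrec_wordsOfLength (m + 2)).comp Primrec.fst) Primrec.id
  exact h.to_comp

variable {l D}

/-- `1 % n` is the value of `(1 : Fin n)`, including the case `n = 1`. -/
theorem wordMatches_ruleWord {n : ℕ} [NeZero n] (s s' : Fin n) (η : Fin m → Fin n)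
    (μ : Equiv.Perm (Fin m)) :
    l.WordMatches D n ((s : ℕ) :: (List.ofFn (fun i => (η i : ℕ)) ++ [(s' : ℕ)])) μ ↔
      l.Matches D η μ := by
  refine forall_congr' fun i => imp_congr_right fun _ => imp_congr_right fun _ => ?_
  rw [getD_ruleWord_neighbour, Fin.ext_iff]
  split <;> simp

/-- By `liftRule_eq` the result does not depend on the matching rotation, so the existential over
`μ` in `IsLiftedRule` admits exactly one new state. -/
theorem isGridTable_liftTable (hG : G.Regular) (hl : l.IsLine) (hD : l.PatternCharacterizes D)
    {n : ℕ} [NeZero n] {A : Fin n → Fin n → Fin n → Fin n} {L : List (List ℕ)}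
    (hL : IsLineTable A L) : IsGridTable (l.liftRule D A) (l.liftTable D (n, L)) := by
  classical
  have key : ∀ (s s' : Fin n) (η : Fin m → Fin n),
      l.IsLiftedRule D ((s : ℕ) :: (List.ofFn (fun i => (η i : ℕ)) ++ [(s' : ℕ)])) (n, L) ↔
        s' = l.liftRule D A s η := by
    intro s s' η
    simp only [IsLiftedRule, wordMatches_ruleWord, getD_ruleWord_neighbour, getD_ruleWord_state,
      getD_ruleWord_newState]
    have hmem : ∀ u v : Fin n, [(u : ℕ), (s : ℕ), (v : ℕ), (s' : ℕ)] ∈ L ↔ s' = A u s v := by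
      intro u v
      rw [hL]
      constructor
      · rintro ⟨u', t, v', h⟩
        simp only [List.cons.injEq, Fin.val_inj, and_true] at h
        obtain ⟨rfl, rfl, rfl, h⟩ := h
        exact h
      · rintro rfl
        exact ⟨u, s, v, rfl⟩
    by_cases h : ∃ μ ∈ G.rotations, l.Matches D η μ
    · simp only [h, not_true_eq_false, false_and, or_false, hmem]
      constructor
      · rintro ⟨μ, ⟨hμ, hη⟩, h'⟩
        rw [liftRule_eq hG hl hD A s hμ hη, h']
      · obtain ⟨μ, hμ, hη⟩ := h
        rw [liftRule_eq hG hl hD A s hμ hη]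
        exact fun h' => ⟨μ, ⟨hμ, hη⟩, h'⟩
    · rw [liftRule_of_not_exists A s h]
      simp only [h, not_false_eq_true, true_and, Fin.val_inj]
      constructor
      · rintro (⟨μ, h', -⟩ | h')
        · exact (h ⟨μ, h'⟩).elim
        · exact h'
      · exact Or.inr
  intro w
  simp only [liftTable, List.mem_filter, mem_wordsOfLength_iff_ruleWord, decide_eq_true_eq]
  constructor
  · rintro ⟨⟨s, η, s', rfl⟩, h⟩
    exact ⟨s, η, by rw [(key s s' η).1 h]⟩
  · rintro ⟨s, η, rfl⟩
    exact ⟨⟨s, η, _, rfl⟩, (key s _ η).2 rfl⟩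

theorem isSimulationAlgorithm_liftTable (hG : G.Regular) (hl : l.IsLine)
    (hD : l.PatternCharacterizes D) : l.IsSimulationAlgorithm D (l.liftTable D) :=
  ⟨l.computable_liftTable D, fun _ _ A _ hL => ⟨l.liftRule D A, isGridTable_liftTable hG hl hD hL,
    rotationInvariant_liftRule hG hl hD A, simulates_liftRule hG hl hD A⟩⟩

end TileLine

/-! ## The dodecagrid -/

/-! ### Rotations of the dodecahedron. -/

theorem IsPositiveMotion.mul {μ μ' : Equiv.Perm (Fin 12)} (h : IsPositiveMotion μ)
    (h' : IsPositiveMotion μ') : IsPositiveMotion (μ * μ') := by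
  intro f
  obtain ⟨k', hk'⟩ := h' f
  obtain ⟨k, hk⟩ := h (μ' f)
  refine ⟨k + k', fun j => ?_⟩
  rw [Equiv.Perm.mul_apply, Equiv.Perm.mul_apply, ← hk', ← hk, add_assoc]

theorem IsPositiveMotion.inv {μ : Equiv.Perm (Fin 12)} (h : IsPositiveMotion μ) :
    IsPositiveMotion μ⁻¹ := by
  intro f
  obtain ⟨k, hk⟩ := h (μ⁻¹ f)
  refine ⟨-k, fun j => ?_⟩
  rw [Equiv.Perm.eq_inv_iff_eq, ← hk, show μ (μ⁻¹ f) = f from μ.apply_symm_apply f,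
    add_neg_cancel_left]

theorem IsNegativeMotion.mul_isPositiveMotion {μ μ' : Equiv.Perm (Fin 12)}
    (h : IsNegativeMotion μ) (h' : IsPositiveMotion μ') : IsNegativeMotion (μ * μ') := by
  intro f
  obtain ⟨k', hk'⟩ := h' f
  obtain ⟨k, hk⟩ := h (μ' f)
  refine ⟨k - k', fun j => ?_⟩
  rw [Equiv.Perm.mul_apply, Equiv.Perm.mul_apply, ← hk', ← hk, sub_sub]

theorem IsNegativeMotion.inv_mul {μ μ' : Equiv.Perm (Fin 12)}
    (h : IsNegativeMotion μ) (h' : IsNegativeMotion μ') : IsPositiveMotion (μ⁻¹ * μ') := by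
  intro f
  obtain ⟨k', hk'⟩ := h' f
  obtain ⟨k, hk⟩ := h ((μ⁻¹ * μ') f)
  refine ⟨k - k', fun j => ?_⟩
  rw [Equiv.Perm.mul_apply μ⁻¹ μ' (facesAround f j), Equiv.Perm.eq_inv_iff_eq, ← hk, ← hk',
    Equiv.Perm.mul_apply, show μ (μ⁻¹ (μ' f)) = μ' f from μ.apply_symm_apply _]
  congr 1
  abel

theorem dodecagrid_rotation_of_tile_eq {F F' : dodecagrid.Frame}
    (h : dodecagrid.tile F = dodecagrid.tile F') : IsPositiveMotion (F.1.2⁻¹ * F'.1.2) := by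
  have h : F.1.1 = F'.1.1 := h
  rcases F.2 with hF | hF <;> rcases F'.2 with hF' | hF'
  · exact hF.2.inv.mul hF'.2
  · exact (hF'.1 (h ▸ hF.1)).elim
  · exact (hF.1 (h ▸ hF'.1)).elim
  · exact hF.2.inv_mul hF'.2

theorem dodecagrid_regular : dodecagrid.Regular where
  mul_mem _ h _ h' := IsPositiveMotion.mul h h'
  inv_mem _ h := IsPositiveMotion.inv h
  exists_rotation F F' h := by
    refine ⟨_, dodecagrid_rotation_of_tile_eq h, fun i => ?_⟩
    have h : F.1.1 = F'.1.1 := h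
    simp [dodecagrid, h]
  exists_frame F μ hμ := by
    refine ⟨⟨(F.1.1, F.1.2 * μ), ?_⟩, rfl, fun i => rfl⟩
    rcases F.2 with hF | hF
    · exact Or.inl ⟨hF.1, hF.2.mul hμ⟩
    · exact Or.inr ⟨hF.1, hF.2.mul_isPositiveMotion hμ⟩

/-- Finite core of `IsPositiveMotion.eq_one_of_redFaces`. Here `f` is the image of the face `0`, and
`k`, `k1`, `k3` are the offsets of the motion around the faces `0`, `1`, `3`. Quantifying over them
instead of over permutations keeps the search small enough for `decide`. -/
theorem facesAround_rigid : ∀ (f : Fin 12) (k : Fin 5),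
    f ∈ dodecaRedFaces ∪ {1, 4} → facesAround f (k + 3) ∈ dodecaRedFaces ∪ {1, 4} →
    facesAround f (k + 4) ∉ dodecaRedFaces → facesAround f (k + 1) ∉ dodecaRedFaces →
    ∀ k1, facesAround (facesAround f k) (k1 + 0) = f →
      facesAround (facesAround f k) (k1 + 2) ∉ dodecaRedFaces →
      facesAround (facesAround f k) (k1 + 3) ∉ dodecaRedFaces →
    ∀ k3, facesAround (facesAround f (k + 3)) (k3 + 0) = f →
      facesAround (facesAround f (k + 3)) (k3 + 2) ∈ dodecaRedFaces ∪ {1, 4} →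
      facesAround (facesAround f (k + 3)) (k3 + 3) ∉ dodecaRedFaces →
    f = 0 ∧ k = 0 := by
  decide

theorem facesAround_injective : ∀ f, Function.Injective (facesAround f) := by
  decide

theorem IsPositiveMotion.apply_facesAround {μ : Equiv.Perm (Fin 12)} (h : IsPositiveMotion μ)
    {f : Fin 12} (hf : μ f = f) {j : Fin 5} (hj : μ (facesAround f j) = facesAround f j)
    (i : Fin 5) : μ (facesAround f i) = facesAround f i := by
  obtain ⟨k, hk⟩ := h f
  rw [hf] at hk
  have hk0 : k = 0 := by
    have := facesAround_injective f ((hk j).trans hj)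
    simpa using this
  rw [← hk, hk0, zero_add]

/-- A fixed face with one fixed neighbour has all its neighbours fixed; this spreads from `0` and
`1` to every face. -/
theorem IsPositiveMotion.eq_one {μ : Equiv.Perm (Fin 12)} (h : IsPositiveMotion μ)
    (h0 : μ 0 = 0) (h1 : μ 1 = 1) : μ = 1 := by
  have a0 := h.apply_facesAround h0 (j := 0) h1
  have a1 := h.apply_facesAround h1 (j := 0) h0
  have a4 := h.apply_facesAround (a0 2 : μ 4 = 4) (j := 0) h0
  have a3 := h.apply_facesAround (a0 3 : μ 3 = 3) (j := 0) h0
  have a6 := h.apply_facesAround (a1 3 : μ 6 = 6) (j := 0) h1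
  have key : ∀ i : Fin 12, μ i = i :=
    Fin.forall_iff_castSucc.2 ⟨(a6 2 : μ 11 = 11), Fin.forall_iff_castSucc.2
      ⟨(a4 2 : μ 10 = 10), Fin.forall_iff_castSucc.2 ⟨(a3 2 : μ 9 = 9), Fin.forall_iff_castSucc.2
      ⟨(a3 3 : μ 8 = 8), Fin.forall_iff_castSucc.2 ⟨(a1 2 : μ 7 = 7), Fin.forall_iff_castSucc.2
      ⟨(a1 3 : μ 6 = 6), Fin.forall_iff_castSucc.2 ⟨(a0 1 : μ 5 = 5), Fin.forall_iff_castSucc.2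
      ⟨(a0 2 : μ 4 = 4), Fin.forall_iff_castSucc.2 ⟨(a0 3 : μ 3 = 3), Fin.forall_iff_castSucc.2
      ⟨(a0 4 : μ 2 = 2), Fin.forall_iff_castSucc.2 ⟨h1, Fin.forall_iff_castSucc.2
      ⟨h0, fun i => i.elim0⟩⟩⟩⟩⟩⟩⟩⟩⟩⟩⟩⟩
  exact Equiv.ext key

/-- The hypotheses are only what survives when the two line neighbours `1` and `4` show unknown
states. -/
theorem IsPositiveMotion.eq_one_of_redFaces {μ : Equiv.Perm (Fin 12)} (h : IsPositiveMotion μ)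
    (hD : ∀ i ∈ dodecaRedFaces, μ i ∈ dodecaRedFaces ∪ {1, 4})
    (hD' : ∀ i ∉ dodecaRedFaces ∪ {1, 4}, μ i ∉ dodecaRedFaces) : μ = 1 := by
  obtain ⟨k, hk⟩ := h 0
  obtain ⟨k1, hk1⟩ := h 1
  obtain ⟨k3, hk3⟩ := h 3
  have e1 : facesAround (μ 0) k = μ 1 := (congrArg _ (add_zero k)).symm.trans (hk 0)
  have e3 : facesAround (μ 0) (k + 3) = μ 3 := hk 3
  rw [← e1] at hk1
  rw [← e3] at hk3
  obtain ⟨h0, rfl⟩ := facesAround_rigid (μ 0) k (hD 0 (by decide))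
    (e3.symm ▸ hD 3 (by decide)) ((hk 4).symm ▸ hD' 2 (by decide))
    ((hk 1).symm ▸ hD' 5 (by decide))
    k1 (hk1 0) ((hk1 2).symm ▸ hD' 7 (by decide)) ((hk1 3).symm ▸ hD' 6 (by decide))
    k3 (hk3 0) ((hk3 2).symm ▸ hD 9 (by decide)) ((hk3 3).symm ▸ hD' 8 (by decide))
  refine h.eq_one h0 ?_
  rw [← e1, h0]
  rfl

/-! ### Homomorphisms from the reflection group of the dodecahedron -/

theorem isLiftable_parity (a : Fin 12) : dodecaCoxeter.IsLiftable
    fun f => Multiplicative.ofAdd (if f = a then (1 : ZMod 2) else 0) := by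
  intro i j
  by_cases h : i = j
  · subst h
    rw [dodecaCoxeter.diagonal, pow_one]
    beta_reduce
    split <;> decide
  · simp only [dodecaCoxeter, Matrix.of_apply, if_neg h]
    by_cases hij : FacesAdjacent i j
    · rw [if_pos hij]
      split <;> split <;> decide
    · rw [if_neg hij, pow_zero]

/-- The number modulo `2` of the reflections in the face `a` in a word representing `w`. -/
noncomputable def faceParity (a : Fin 12) (w : DodecaGroup) : ZMod 2 :=
  (dodecaCoxeter.toCoxeterSystem.lift ⟨_, isLiftable_parity a⟩ w).toAdd

theorem faceParity_mul (a : Fin 12) (v w : DodecaGroup) :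
    faceParity a (v * w) = faceParity a v + faceParity a w := by
  simp [faceParity]

theorem faceParity_refl (a f : Fin 12) :
    faceParity a (dodecaRefl f) = if f = a then 1 else 0 := by
  have := dodecaCoxeter.toCoxeterSystem.lift_apply_simple (isLiftable_parity a) f
  rw [faceParity, dodecaRefl]
  exact congrArg Multiplicative.toAdd this

theorem dodecaRefl_mul_self (f : Fin 12) : dodecaRefl f * dodecaRefl f = 1 :=
  dodecaCoxeter.toCoxeterSystem.simple_mul_simple_self f

/-- The action of the reflection in the face `f` on the positions along the guideline. -/
def lineReflection (f : Fin 12) : Equiv.Perm ℤ :=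
  if f = 1 then Equiv.subLeft (-1) else if f = 4 then Equiv.subLeft 1 else 1

/-- The faces `1` and `4` share no edge, so no relation ties their reflections, and in every
commutation relation one of the two factors acts trivially. -/
theorem isLiftable_lineReflection : dodecaCoxeter.IsLiftable lineReflection := by
  have hsq : ∀ i, lineReflection i * lineReflection i = 1 := by
    intro i
    ext x
    unfold lineReflection
    split
    · simp
    · split <;> simp
  have hadj : ∀ i j, FacesAdjacent i j → (i ≠ 1 ∧ i ≠ 4) ∨ (j ≠ 1 ∧ j ≠ 4) := by decide
  intro i j
  by_cases h : i = j
  · subst h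
    rw [dodecaCoxeter.diagonal, pow_one, hsq]
  · simp only [dodecaCoxeter, Matrix.of_apply, if_neg h]
    split
    · rename_i hij
      rcases hadj i j hij with hi | hj
      · have : lineReflection i = 1 := by rw [lineReflection, if_neg hi.1, if_neg hi.2]
        rw [this, one_mul, sq, hsq]
      · have : lineReflection j = 1 := by rw [lineReflection, if_neg hj.1, if_neg hj.2]
        rw [this, mul_one, sq, hsq]
    · rw [pow_zero]

/-! ### The line -/

theorem dodecaLineTile_two_mul (j : ℤ) :
    dodecaLineTile (2 * j) = (dodecaRefl 4 * dodecaRefl 1) ^ j := by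
  have : Even (2 * j) := even_two_mul j
  rw [dodecaLineTile, if_pos this, mul_one, Int.mul_ediv_cancel_left _ two_ne_zero]

theorem dodecaLineTile_two_mul_add_one (j : ℤ) :
    dodecaLineTile (2 * j + 1) = (dodecaRefl 4 * dodecaRefl 1) ^ j * dodecaRefl 4 := by
  have : ¬ Even (2 * j + 1) := Int.not_even_two_mul_add_one j
  rw [dodecaLineTile, if_neg this]
  congr 2
  omega

theorem dodecaLineNumbering_two_mul (j : ℤ) : dodecaLineNumbering (2 * j) = 1 :=
  if_pos (even_two_mul j)

theorem dodecaLineNumbering_two_mul_add_one (j : ℤ) :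
    dodecaLineNumbering (2 * j + 1) = dodecaMirror :=
  if_neg (Int.not_even_two_mul_add_one j)

theorem dodecaLineTile_mul_right (k : ℤ) :
    dodecaLineTile k * dodecaRefl (dodecaLineNumbering k 4) = dodecaLineTile (k + 1) := by
  obtain ⟨j, rfl | rfl⟩ := Int.even_or_odd' k
  · rw [dodecaLineTile_two_mul, dodecaLineTile_two_mul_add_one, dodecaLineNumbering_two_mul]
    rfl
  · rw [dodecaLineTile_two_mul_add_one, dodecaLineNumbering_two_mul_add_one,
      show 2 * j + 1 + 1 = 2 * (j + 1) by ring, dodecaLineTile_two_mul,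
      show dodecaMirror 4 = 1 by decide, zpow_add_one, mul_assoc]

theorem dodecaLineTile_mul_left (k : ℤ) :
    dodecaLineTile k * dodecaRefl (dodecaLineNumbering k 1) = dodecaLineTile (k - 1) := by
  have hm : dodecaLineNumbering k 1 = dodecaLineNumbering (k - 1) 4 := by
    obtain ⟨j, rfl | rfl⟩ := Int.even_or_odd' k
    · rw [show 2 * j - 1 = 2 * (j - 1) + 1 by ring, dodecaLineNumbering_two_mul,
        dodecaLineNumbering_two_mul_add_one]
      decide
    · rw [add_sub_cancel_right, dodecaLineNumbering_two_mul, dodecaLineNumbering_two_mul_add_one]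
      decide
  have := dodecaLineTile_mul_right (k - 1)
  rw [sub_add_cancel] at this
  rw [← this, hm, mul_assoc, dodecaRefl_mul_self, mul_one]

/-- In the action on positions, the product of the reflections `4` and `1` is the translation by
`2`, and the tile number `k` sends `0` to `k`. -/
theorem dodecaLineTile_injective : Function.Injective dodecaLineTile := by
  set ψ := dodecaCoxeter.toCoxeterSystem.lift ⟨_, isLiftable_lineReflection⟩ with hψ
  have hs : ∀ f, ψ (dodecaRefl f) = lineReflection f := fun f =>
    dodecaCoxeter.toCoxeterSystem.lift_apply_simple isLiftable_lineReflection f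
  have hpow : ∀ j : ℤ, ψ ((dodecaRefl 4 * dodecaRefl 1) ^ j) = Equiv.addRight (2 * j) := by
    intro j
    have h2 : ψ (dodecaRefl 4 * dodecaRefl 1) = Equiv.addRight (2 : ℤ) := by
      rw [map_mul, hs, hs]
      ext x
      simp [lineReflection]
      ring
    rw [map_zpow, h2]
    induction j using Int.induction_on with
    | zero => ext x; simp
    | succ j ih => rw [zpow_add_one, ih]; ext x; simp; ring
    | pred j ih => rw [zpow_sub_one, ih]; ext x; simp; ring
  have key : ∀ k, ψ (dodecaLineTile k) 0 = k := by
    intro k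
    obtain ⟨j, rfl | rfl⟩ := Int.even_or_odd' k
    · rw [dodecaLineTile_two_mul, hpow]; simp
    · rw [dodecaLineTile_two_mul_add_one, map_mul, hpow, hs]
      simp [lineReflection]
      ring
  intro k k' h
  rw [← key k, ← key k', h]

theorem dodecaLine_isLine : dodecaLine.IsLine :=
  ⟨dodecaLineTile_injective, fun k => ⟨dodecaLineTile_mul_right k, dodecaLineTile_mul_left k⟩⟩

/-! ### Neighbours on the line and red neighbours, by parities. -/

theorem faceParity_dodecaLineTile {a : Fin 12} (h1 : a ≠ 1) (h4 : a ≠ 4) (k : ℤ) :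
    faceParity a (dodecaLineTile k) = 0 := by
  rw [dodecaLineTile, faceParity, map_mul, map_zpow, toAdd_mul, toAdd_zpow]
  change _ • faceParity a _ + faceParity a _ = 0
  rw [faceParity_mul, faceParity_refl, faceParity_refl, if_neg h1.symm, if_neg h4.symm, add_zero,
    smul_zero, zero_add]
  split
  · simp [faceParity]
  · rw [faceParity_refl, if_neg h4.symm]

theorem dodecaLineNumbering_mem_ends (k : ℤ) {i : Fin 12} :
    (dodecaLineNumbering k i = 1 ∨ dodecaLineNumbering k i = 4) ↔ i = 1 ∨ i = 4 := by
  revert i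
  unfold dodecaLineNumbering
  split <;> decide

theorem exists_of_mem_red {T : DodecaGroup} (hT : T ∈ dodecaLine.red dodecaRedFaces) :
    ∃ k g, g ≠ 1 ∧ g ≠ 4 ∧ (dodecaLineNumbering k)⁻¹ g ∈ dodecaRedFaces ∧
      T = dodecaLineTile k * dodecaRefl g := by
  obtain ⟨k, i, hi, rfl⟩ := hT
  have h : ¬ (i = 1 ∨ i = 4) := by revert i; decide
  rw [← dodecaLineNumbering_mem_ends k, not_or] at h
  exact ⟨k, _, h.1, h.2, by simpa using hi, rfl⟩

theorem dodecaLineTile_mul_refl_mem_range {k : ℤ} {f : Fin 12}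
    (h : dodecaLineTile k * dodecaRefl f ∈ Set.range dodecaLineTile) : f = 1 ∨ f = 4 := by
  by_contra! hf
  obtain ⟨k', h⟩ := h
  have := congrArg (faceParity f) h
  rw [faceParity_mul, faceParity_dodecaLineTile hf.1 hf.2, faceParity_dodecaLineTile hf.1 hf.2,
    faceParity_refl, if_pos rfl] at this
  exact absurd this (by decide)

theorem dodecaLineTile_mul_refl_ends (k : ℤ) {f : Fin 12} (hf : f = 1 ∨ f = 4) :
    dodecaLineTile k * dodecaRefl f ∈ Set.range dodecaLineTile := by
  have h : (dodecaLineNumbering k)⁻¹ f = 1 ∨ (dodecaLineNumbering k)⁻¹ f = 4 := by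
    rw [← dodecaLineNumbering_mem_ends k]
    simpa using hf
  rcases h with h | h
  · rw [Equiv.Perm.inv_eq_iff_eq] at h
    exact ⟨k - 1, by rw [h, dodecaLineTile_mul_left]⟩
  · rw [Equiv.Perm.inv_eq_iff_eq] at h
    exact ⟨k + 1, by rw [h, dodecaLineTile_mul_right]⟩

theorem dodecaLineTile_mul_refl_mem_red {k : ℤ} {f : Fin 12}
    (h : dodecaLineTile k * dodecaRefl f ∈ dodecaLine.red dodecaRedFaces) :
    (dodecaLineNumbering k)⁻¹ f ∈ dodecaRedFaces := by
  obtain ⟨k', g, h1, h4, hg, h⟩ := exists_of_mem_red h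
  have hfg : f = g := by
    by_contra hfg
    have := congrArg (faceParity g) h
    rw [faceParity_mul, faceParity_mul, faceParity_dodecaLineTile h1 h4,
      faceParity_dodecaLineTile h1 h4, faceParity_refl, faceParity_refl, if_neg hfg,
      if_pos rfl] at this
    exact absurd this (by decide)
  subst hfg
  rw [dodecaLineTile_injective (mul_right_cancel h)]
  exact hg

theorem dodecaLineTile_mul_refl_numbering_mem_red {k : ℤ} {i : Fin 12}
    (h : dodecaLineTile k * dodecaRefl (dodecaLineNumbering k i) ∈ dodecaLine.red dodecaRedFaces) :
    i ∈ dodecaRedFaces := by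
  simpa using dodecaLineTile_mul_refl_mem_red h

/-- If a red cell is seen through `f` other than `1`, `4`, and is the neighbour of a line cell
through `g`, then outside `1` and `4` the odd parities of `w` are exactly those of `f` and `g`, with
`f ≠ g` since `w` is off the line. Any other red neighbour must give the same pair. Otherwise only
the faces `1` and `4` remain. -/
theorem exists_two_red_faces {w : DodecaGroup} (hw : w ∉ Set.range dodecaLineTile) :
    ∃ a b, ∀ f, w * dodecaRefl f ∈ dodecaLine.red dodecaRedFaces → f = a ∨ f = b := by
  by_cases hex : ∃ f, (f ≠ 1 ∧ f ≠ 4) ∧ w * dodecaRefl f ∈ dodecaLine.red dodecaRedFaces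
  · obtain ⟨f, hf, hr⟩ := hex
    obtain ⟨k, g, hg1, hg4, -, hk⟩ := exists_of_mem_red hr
    have hfg : g ≠ f := by
      rintro rfl
      exact hw ⟨k, (mul_right_cancel hk).symm⟩
    have hpar : ∀ a, a ≠ 1 → a ≠ 4 →
        faceParity a w + faceParity a (dodecaRefl f) = faceParity a (dodecaRefl g) := by
      intro a h1 h4
      rw [← faceParity_mul, hk, faceParity_mul, faceParity_dodecaLineTile h1 h4, zero_add]
    refine ⟨f, g, fun f' hr' => ?_⟩
    obtain ⟨k', g', hg1', hg4', -, hk'⟩ := exists_of_mem_red hr'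
    have hfg' : g' ≠ f' := by
      rintro rfl
      exact hw ⟨k', (mul_right_cancel hk').symm⟩
    have hpar' : ∀ a, a ≠ 1 → a ≠ 4 →
        faceParity a w + faceParity a (dodecaRefl f') = faceParity a (dodecaRefl g') := by
      intro a h1 h4
      rw [← faceParity_mul, hk', faceParity_mul, faceParity_dodecaLineTile h1 h4, zero_add]
    have key : ∀ a, a ≠ 1 → a ≠ 4 → (if f = a then (1 : ZMod 2) else 0) + (if g = a then 1 else 0) =
        (if f' = a then 1 else 0) + (if g' = a then 1 else 0) := by
      intro a h1 h4
      have e := hpar a h1 h4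
      have e' := hpar' a h1 h4
      simp only [faceParity_refl] at e e'
      rw [← e, ← e', add_left_comm, CharTwo.add_self_eq_zero, add_left_comm,
        CharTwo.add_self_eq_zero]
    by_contra! hne
    by_cases hf' : f' ≠ 1 ∧ f' ≠ 4
    · have := key f' hf'.1 hf'.2
      rw [if_neg hne.1.symm, if_neg hne.2.symm, if_pos rfl, if_neg hfg'] at this
      exact absurd this (by decide)
    -- Through `1` or `4`, only the parity of `g'` would be odd, whereas those of both `f` and `g`
    -- are.
    · have hne' : ∀ a, a ≠ 1 → a ≠ 4 → f' ≠ a := by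
        rintro a h1 h4 rfl
        exact hf' ⟨h1, h4⟩
      have e := key f hf.1 hf.2
      have e' := key g hg1 hg4
      rw [if_pos rfl, if_neg hfg, if_neg (hne' f hf.1 hf.2)] at e
      rw [if_pos rfl, if_neg hfg.symm, if_neg (hne' g hg1 hg4)] at e'
      have h1 : g' = f := by
        by_contra h
        rw [if_neg h] at e
        exact absurd e (by decide)
      have h2 : g' = g := by
        by_contra h
        rw [if_neg h] at e'
        exact absurd e' (by decide)
      exact hfg (h2.symm.trans h1)
  · refine ⟨1, 4, fun f hf => ?_⟩
    by_contra! h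
    exact hex ⟨f, h, hf⟩

/-- Such a face is neither `1` nor `4`, since crossing these from a line tile stays on the line;
hence it is the only one of odd parity in `w`. -/
theorem exists_line_face {w : DodecaGroup} (hw : w ∉ Set.range dodecaLineTile) :
    ∃ c, ∀ f, w * dodecaRefl f ∈ Set.range dodecaLineTile → f = c := by
  by_cases hex : ∃ f, w * dodecaRefl f ∈ Set.range dodecaLineTile
  · obtain ⟨c, k, hk⟩ := hex
    have hw' : ∀ f k', dodecaLineTile k' = w * dodecaRefl f → f ≠ 1 ∧ f ≠ 4 := by
      intro f k' h
      rw [← not_or]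
      intro hf
      apply hw
      have := dodecaLineTile_mul_refl_ends k' hf
      rwa [h, mul_assoc, dodecaRefl_mul_self, mul_one] at this
    obtain ⟨h1, h4⟩ := hw' c k hk
    refine ⟨c, ?_⟩
    rintro f ⟨k', hk'⟩
    have e := congrArg (faceParity c) hk
    have e' := congrArg (faceParity c) hk'
    rw [faceParity_mul, faceParity_dodecaLineTile h1 h4, faceParity_refl] at e e'
    by_contra hne
    rw [if_neg hne, add_zero] at e'
    rw [if_pos rfl, ← e', zero_add] at e
    exact absurd e (by decide)
  · exact ⟨0, fun f hf => (hex ⟨f, hf⟩).elim⟩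

theorem dodecaLine_ncard_redNeighbours (k : ℤ) :
    (dodecaLine.redNeighbours dodecaRedFaces (dodecaLine.frame k)).ncard = 4 := by
  have h : dodecaLine.redNeighbours dodecaRedFaces (dodecaLine.frame k) =
      (fun i => dodecaLineTile k * dodecaRefl (dodecaLineNumbering k i)) ''
        (dodecaRedFaces : Set (Fin 12)) := by
    ext T
    constructor
    · rintro ⟨hT, i, rfl⟩
      exact ⟨i, dodecaLineTile_mul_refl_numbering_mem_red hT, rfl⟩
    · rintro ⟨i, hi, rfl⟩
      exact ⟨⟨k, i, hi, rfl⟩, i, rfl⟩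
  rw [h]
  refine (Set.InjOn.ncard_image ?_).trans (Set.ncard_coe_finset _)
  intro i hi i' hi' h
  have hends : ∀ i ∈ dodecaRedFaces, ¬ (i = 1 ∨ i = 4) := by decide
  have hn := hends i hi
  rw [← dodecaLineNumbering_mem_ends k, not_or] at hn
  have := congrArg (faceParity (dodecaLineNumbering k i)) (mul_left_cancel h)
  rw [faceParity_refl, faceParity_refl, if_pos rfl] at this
  by_contra hne
  rw [if_neg fun h => hne ((dodecaLineNumbering k).injective h).symm] at this
  exact absurd this (by decide)

theorem dodecaLine_ncard_redNeighbours_le (F : dodecagrid.Frame)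
    (hF : dodecagrid.tile F ∉ Set.range dodecaLine.cell) :
    (dodecaLine.redNeighbours dodecaRedFaces F).ncard ≤ 2 := by
  obtain ⟨a, b, hab⟩ := exists_two_red_faces hF
  refine le_trans (Set.ncard_le_ncard (t := {F.1.1 * dodecaRefl a, F.1.1 * dodecaRefl b}) ?_)
    ((Set.ncard_insert_le _ _).trans (by rw [Set.ncard_singleton]))
  rintro T ⟨hT, i, rfl⟩
  rcases hab _ hT with h | h
  · exact Or.inl (congrArg (fun f => F.1.1 * dodecaRefl f) h)
  · exact Or.inr (congrArg (fun f => F.1.1 * dodecaRefl f) h)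

theorem dodecaLine_patternCharacterizes : dodecaLine.PatternCharacterizes dodecaRedFaces := by
  have hends : ∀ i ∈ dodecaRedFaces, i ≠ 1 ∧ i ≠ 4 := by decide
  intro n _ hn x F
  constructor
  · intro h
    have hred : ∀ i ∈ dodecaRedFaces, F.1.1 * dodecaRefl (F.1.2 i) ∈ dodecaLine.red dodecaRedFaces ∨
        F.1.1 * dodecaRefl (F.1.2 i) ∈ Set.range dodecaLineTile := fun i hi =>
      h.mem_red_or_mem_range hn (hends i hi).1 (hends i hi).2 hi
    by_cases hF : F.1.1 ∈ Set.range dodecaLineTile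
    · obtain ⟨k, hk⟩ := hF
      have hpos : IsPositiveMotion ((dodecaLineNumbering k)⁻¹ * F.1.2) :=
        dodecagrid_rotation_of_tile_eq (F := dodecaLine.frame k) hk
      have hone := hpos.eq_one_of_redFaces (fun i hi => ?_) fun i hi => ?_
      · refine ⟨k, Subtype.ext (Prod.ext hk.symm ?_)⟩
        exact (inv_mul_eq_one.1 hone).symm
      · have := hred i hi
        rw [← hk] at this
        rw [Finset.mem_union]
        refine this.imp dodecaLineTile_mul_refl_mem_red fun h => ?_
        have := dodecaLineTile_mul_refl_mem_range h
        rw [Finset.mem_insert, Finset.mem_singleton, ← dodecaLineNumbering_mem_ends k]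
        simpa using this
      · simp only [Finset.mem_union, Finset.mem_insert, Finset.mem_singleton, not_or] at hi
        intro hmem
        have := h.notMem_red_or_mem_range hn hi.2.1 hi.2.2 hi.1
        change F.1.1 * dodecaRefl (F.1.2 i) ∉ _ ∨ F.1.1 * dodecaRefl (F.1.2 i) ∈
          Set.range dodecaLineTile at this
        rw [← hk] at this
        rcases this with hr | hr
        · refine hr ⟨k, _, hmem, ?_⟩
          change dodecaLineTile k * dodecaRefl (dodecaLineNumbering k _) = _
          simp
        · have hr := dodecaLineTile_mul_refl_mem_range hr
          have := hends _ hmem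
          rw [← not_or, ← dodecaLineNumbering_mem_ends k] at this
          simp [hr] at this
    · obtain ⟨a, b, hab⟩ := exists_two_red_faces hF
      obtain ⟨c, hc⟩ := exists_line_face hF
      -- Four distinct faces would have to fit among two red ones and one leading to the line.
      have hsub : dodecaRedFaces.image F.1.2 ⊆ {a, b, c} := by
        intro f hf
        obtain ⟨i, hi, rfl⟩ := Finset.mem_image.1 hf
        simp only [Finset.mem_insert, Finset.mem_singleton]
        rcases hred i hi with h | h
        · rcases hab _ h with h | h <;> simp [h]
        · simp [hc _ h]
      have h1 := Finset.card_le_card hsub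
      rw [Finset.card_image_of_injective _ F.1.2.injective] at h1
      have h2 := h1.trans Finset.card_le_three
      exact absurd h2 (by decide)
  · rintro ⟨k, rfl⟩
    refine TileLine.seesPattern_frame (fun k i hi hi' => ⟨fun h => ?_, fun h => ?_⟩) x k
    · have := dodecaLineTile_mul_refl_mem_range h
      have := (dodecaLineNumbering_mem_ends k).1 this
      exact this.elim hi hi'
    · exact dodecaLineTile_mul_refl_numbering_mem_red h

/-! ## The heptagrid -/

/-! ### Relations in the triangle group -/

theorem heptaRot_pow_seven : heptaRot ^ 7 = 1 :=
  PresentedGroup.one_of_mem (rels := triangleRelations) (x := FreeGroup.of 0 ^ 7) (by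
    simp [triangleRelations])

theorem heptaHalf_mul_self : heptaHalf * heptaHalf = 1 := by
  rw [← sq]
  exact PresentedGroup.one_of_mem (rels := triangleRelations) (x := FreeGroup.of 1 ^ 2) (by
    simp [triangleRelations])

theorem heptaRot_mul_heptaHalf_pow_three : (heptaRot * heptaHalf) ^ 3 = 1 :=
  PresentedGroup.one_of_mem (rels := triangleRelations)
    (x := (FreeGroup.of 0 * FreeGroup.of 1) ^ 3) (by simp [triangleRelations])

/-- The product of half-turns is `a b a b a⁻²`, and `(ab)³ = 1` turns `abab` into `(ab)⁻¹`. -/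
theorem heptaShift_eq : heptaShift = (heptaRot ^ 3 * heptaHalf)⁻¹ := by
  have hb : heptaHalf⁻¹ = heptaHalf := inv_eq_of_mul_eq_one_left heptaHalf_mul_self
  have h : heptaRot * heptaHalf * (heptaRot * heptaHalf) = (heptaRot * heptaHalf)⁻¹ := by
    rw [eq_inv_iff_mul_eq_one, ← heptaRot_mul_heptaHalf_pow_three, pow_three']
  calc heptaShift = heptaRot * heptaHalf * (heptaRot * heptaHalf) * (heptaRot ^ 2)⁻¹ := by
        simp only [heptaShift, heptaSideHalf]; group
    _ = _ := by rw [h]; group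

theorem heptaRot_pow_val_add (i j : Fin 7) :
    heptaRot ^ ((i + j : Fin 7) : ℕ) = heptaRot ^ (i : ℕ) * heptaRot ^ (j : ℕ) := by
  rw [Fin.val_add, ← pow_add, ← pow_eq_pow_mod _ heptaRot_pow_seven]

theorem heptaTile_eq_iff {g h : TriangleGroup} :
    heptagrid.tile g = heptagrid.tile h ↔ ∃ j : Fin 7, h = g * heptaRot ^ (j : ℕ) := by
  change (g : TriangleGroup ⧸ Subgroup.zpowers heptaRot) = h ↔ _
  rw [QuotientGroup.eq]
  constructor
  · intro hmem
    have hfin : IsOfFinOrder heptaRot := isOfFinOrder_iff_pow_eq_one.2 ⟨7, by norm_num,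
      heptaRot_pow_seven⟩
    obtain ⟨n, hn⟩ := (hfin.mem_powers_iff_mem_zpowers.2 hmem)
    refine ⟨⟨n % 7, Nat.mod_lt _ (by norm_num)⟩, ?_⟩
    rw [← pow_eq_pow_mod _ heptaRot_pow_seven, show heptaRot ^ n = g⁻¹ * h from hn,
      mul_inv_cancel_left]
  · rintro ⟨j, rfl⟩
    rw [inv_mul_cancel_left]
    exact Subgroup.pow_mem _ (Subgroup.mem_zpowers _) _

theorem heptagrid_nbr (g : TriangleGroup) (i : Fin 7) :
    heptagrid.nbr g i = heptagrid.tile (g * heptaRot ^ (i : ℕ) * heptaHalf) := rfl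

theorem heptagrid_nbr_mul_rot (g : TriangleGroup) (i j : Fin 7) :
    heptagrid.nbr (g * heptaRot ^ (j : ℕ) : TriangleGroup) i = heptagrid.nbr g (i + j) := by
  rw [heptagrid_nbr, heptagrid_nbr, add_comm, heptaRot_pow_val_add, mul_assoc g]

theorem heptagrid_regular : heptagrid.Regular where
  mul_mem := by
    rintro μ ⟨k, hk⟩ μ' ⟨k', hk'⟩
    exact ⟨k' + k, fun i => by rw [Equiv.Perm.mul_apply, hk, hk', add_assoc]⟩
  inv_mem := by
    rintro μ ⟨k, hk⟩
    exact ⟨-k, fun i => by rw [Equiv.Perm.inv_eq_iff_eq, hk, neg_add_cancel_right]⟩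
  exists_rotation g g' h := by
    obtain ⟨j, rfl⟩ := heptaTile_eq_iff.1 h
    exact ⟨Equiv.addRight j, ⟨j, fun i => rfl⟩, fun i => heptagrid_nbr_mul_rot g i j⟩
  exists_frame := by
    rintro (g : TriangleGroup) μ ⟨k, hk⟩
    refine ⟨(g * heptaRot ^ (k : ℕ) : TriangleGroup), (heptaTile_eq_iff.2 ⟨k, rfl⟩).symm,
      fun i => ?_⟩
    rw [hk, heptagrid_nbr_mul_rot]

/-! ### Linear representations of the triangle group -/

section Representation

variable {R : Type*} [CommRing R]

/-- The action on covectors of the rotation of order `7`, where `c` stands for `2 cos (2π/7)`. -/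
def covRot (c : R) : Equiv.Perm (R × R × R) where
  toFun p := ((1 + c) * p.1 + (2 + c) * p.2.1, -p.1 - p.2.1, p.1 + p.2.2)
  invFun p := (-p.1 - (2 + c) * p.2.1, p.1 + (1 + c) * p.2.1, p.2.2 + p.1 + (2 + c) * p.2.1)
  left_inv p := by ext <;> dsimp only <;> ring
  right_inv p := by ext <;> dsimp only <;> ring

/-- The action on covectors of the half-turn, where `c` stands for `2 cos (2π/7)`. -/
def covHalf (c : R) : Equiv.Perm (R × R × R) where
  toFun p := (p.1 + (2 + c) * p.2.1 + p.2.2, -p.2.1, -p.2.2)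
  invFun p := (p.1 + (2 + c) * p.2.1 + p.2.2, -p.2.1, -p.2.2)
  left_inv p := by ext <;> dsimp only <;> ring
  right_inv p := by ext <;> dsimp only <;> ring

theorem covRot_apply (c x y z : R) :
    covRot c (x, y, z) = ((1 + c) * x + (2 + c) * y, -x - y, x + z) := rfl

theorem covHalf_apply (c x y z : R) :
    covHalf c (x, y, z) = (x + (2 + c) * y + z, -y, -z) := rfl

variable {c : R}

/-- Reducing the cube by the equation of `c` keeps the degrees low, both in the seventh power (`7 =
3 + 3 + 1`) and in the action of the shift. -/
theorem covRot_pow_three_apply (hc : c ^ 3 + c ^ 2 - 2 * c - 1 = 0) (x y z : R) :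
    covRot c (covRot c (covRot c (x, y, z))) =
      ((c ^ 2 + c - 1) * y, (1 - c ^ 2) * x + (1 - c - c ^ 2) * y,
        (1 + 2 * c + c ^ 2) * x + (2 + 3 * c + c ^ 2) * y + z) := by
  simp only [covRot_apply, Prod.mk.injEq]
  refine ⟨?_, ?_, ?_⟩
  · linear_combination (x + y) * hc
  · ring
  · ring

theorem covRot_pow_seven (hc : c ^ 3 + c ^ 2 - 2 * c - 1 = 0) : covRot c ^ 7 = 1 := by
  ext1 ⟨x, y, z⟩
  change covRot c (covRot c (covRot c (covRot c (covRot c (covRot c (covRot c (x, y, z))))))) = _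
  rw [covRot_pow_three_apply hc, covRot_pow_three_apply hc, covRot_apply, Equiv.Perm.one_apply]
  simp only [Prod.mk.injEq]
  refine ⟨?_, ?_, ?_⟩ <;> grind

theorem covHalf_mul_covRot_pow_three (c : R) :
    (covHalf c * covRot c) ^ 3 = 1 := by
  ext1 ⟨x, y, z⟩
  change covHalf c (covRot c (covHalf c (covRot c (covHalf c (covRot c (x, y, z)))))) = _
  simp only [covRot_apply, covHalf_apply, Equiv.Perm.one_apply, Prod.mk.injEq]
  refine ⟨?_, ?_, ?_⟩ <;> grind

theorem covHalf_sq (c : R) : covHalf c ^ 2 = 1 := by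
  ext1 p
  exact (covHalf c).left_inv p

/-- The action of the triangle group on covectors, where `c` stands for `2 cos (2π/7)`. -/
noncomputable def covRep (hc : c ^ 3 + c ^ 2 - 2 * c - 1 = 0) :
    TriangleGroup →* Equiv.Perm (R × R × R) :=
  PresentedGroup.toGroup (f := ![(covRot c)⁻¹, (covHalf c)⁻¹]) (by
    intro r hr
    simp only [triangleRelations, Set.mem_insert_iff, Set.mem_singleton_iff] at hr
    rcases hr with rfl | rfl | rfl
    · simp [covRot_pow_seven hc]
    · simp [covHalf_sq]
    · simp only [map_pow, map_mul, FreeGroup.lift_apply_of, Matrix.cons_val_zero,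
        Matrix.cons_val_one]
      rw [← mul_inv_rev, inv_pow, covHalf_mul_covRot_pow_three, inv_one])

/-- The right action of the triangle group on covectors. -/
noncomputable def covAct (hc : c ^ 3 + c ^ 2 - 2 * c - 1 = 0) (p : R × R × R)
    (g : TriangleGroup) : R × R × R :=
  covRep hc g⁻¹ p

variable (hc : c ^ 3 + c ^ 2 - 2 * c - 1 = 0)

theorem covAct_mul (p : R × R × R) (g h : TriangleGroup) :
    covAct hc p (g * h) = covAct hc (covAct hc p g) h := by
  rw [covAct, mul_inv_rev, map_mul]
  rfl

theorem covAct_one (p : R × R × R) : covAct hc p 1 = p := by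
  rw [covAct, inv_one, map_one]
  rfl

theorem covAct_rot (p : R × R × R) : covAct hc p heptaRot = covRot c p := by
  rw [covAct, map_inv, heptaRot, covRep, PresentedGroup.toGroup.of]
  rfl

theorem covAct_half (p : R × R × R) : covAct hc p heptaHalf = covHalf c p := by
  rw [covAct, map_inv, heptaHalf, covRep, PresentedGroup.toGroup.of]
  rfl

theorem covAct_rot_pow (p : R × R × R) (i : ℕ) :
    covAct hc p (heptaRot ^ i) = (covRot c)^[i] p := by
  induction i with
  | zero => exact covAct_one hc p
  | succ i ih => rw [pow_succ, covAct_mul, ih, covAct_rot, Function.iterate_succ_apply']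

theorem covAct_zpow {p : R × R × R} {g : TriangleGroup} (h : covAct hc p g = p) (k : ℤ) :
    covAct hc p (g ^ k) = p := by
  rw [covAct, ← inv_zpow, map_zpow]
  exact Function.IsFixedPt.perm_zpow h k

end Representation

/-! ### The shift has infinite order -/

theorem exists_real_root : ∃ c : ℝ, 1 < c ∧ c ^ 3 + c ^ 2 - 2 * c - 1 = 0 := by
  have hcont : ContinuousOn (fun c : ℝ => c ^ 3 + c ^ 2 - 2 * c - 1) (Set.Icc 1 2) := by fun_prop
  obtain ⟨c, hc, h⟩ := intermediate_value_Ioo (by norm_num) hcont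
    (show (0 : ℝ) ∈ _ by constructor <;> norm_num)
  exact ⟨c, hc.1, h⟩

/-- The first coordinate of the orbit of `(1, 0, -2)` under the inverse of the shift is strictly
increasing, so no positive power is trivial. -/
theorem not_isOfFinOrder_heptaShift : ¬ IsOfFinOrder heptaShift := by
  rw [heptaShift_eq, isOfFinOrder_inv_iff, isOfFinOrder_iff_pow_eq_one]
  rintro ⟨N, hN, h⟩
  obtain ⟨c, hc1, hc⟩ := exists_real_root
  set r : ℕ → ℝ × ℝ × ℝ := fun k => covAct hc (1, 0, -2) ((heptaRot ^ 3 * heptaHalf) ^ k) with hr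
  have hsucc : ∀ k, r (k + 1) = covHalf c (covRot c (covRot c (covRot c (r k)))) := by
    intro k
    simp only [hr]
    rw [pow_succ, covAct_mul, covAct_mul, covAct_half, covAct_rot_pow]
    rfl
  have h0 : r 0 = (1, 0, -2) := by simp only [hr]; rw [pow_zero, covAct_one]
  have hinv : ∀ k, 0 < (r k).1 ∧ 0 ≤ (r k).2.1 ∧ (r k).2.2 = -2 * (r k).1 - (r k).2.1 ∧
      (r k).1 < (r (k + 1)).1 := by
    -- The plane `2x + y + z = 0` is invariant, and the matrix on it has positive entries because `c
    -- > 1`.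
    have hstep : ∀ x y : ℝ, covHalf c (covRot c (covRot c (covRot c (x, y, -2 * x - y)))) =
        (c * x + (1 + c) * y, (c ^ 2 - 1) * x + (c ^ 2 + c - 1) * y,
          -2 * (c * x + (1 + c) * y) - ((c ^ 2 - 1) * x + (c ^ 2 + c - 1) * y)) := by
      intro x y
      rw [covRot_pow_three_apply hc, covHalf_apply]
      simp only [Prod.mk.injEq]
      refine ⟨?_, ?_, ?_⟩ <;> grind
    have hlt : ∀ x y : ℝ, 0 < x → 0 ≤ y → x < c * x + (1 + c) * y := by
      intro x y hx hy
      have : 0 ≤ (1 + c) * y := by positivity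
      nlinarith
    intro k
    induction k with
    | zero =>
      rw [hsucc, h0]
      have := hstep 1 0
      norm_num at this
      rw [this]
      norm_num
      exact hc1
    | succ k ih =>
      obtain ⟨h1, h2, h3, h4⟩ := ih
      have e : r k = ((r k).1, (r k).2.1, -2 * (r k).1 - (r k).2.1) := by rw [← h3]
      have e' := hsucc k
      rw [e, hstep] at e'
      have hx := h1.trans h4
      have hy : 0 ≤ (r (k + 1)).2.1 := by
        rw [e']
        have : 0 ≤ (c ^ 2 - 1) * (r k).1 := mul_nonneg (by nlinarith) h1.le
        have : 0 ≤ (c ^ 2 + c - 1) * (r k).2.1 := mul_nonneg (by nlinarith) h2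
        dsimp only
        linarith
      have hz : (r (k + 1)).2.2 = -2 * (r (k + 1)).1 - (r (k + 1)).2.1 := by rw [e']
      refine ⟨hx, hy, hz, ?_⟩
      have e2 : r (k + 1) = ((r (k + 1)).1, (r (k + 1)).2.1,
        -2 * (r (k + 1)).1 - (r (k + 1)).2.1) := by rw [← hz]
      rw [hsucc (k + 1), e2, hstep]
      exact hlt _ _ hx hy
  have hmono : StrictMono fun k => (r k).1 := strictMono_nat_of_lt_succ fun k => (hinv k).2.2.2
  have := hmono hN
  simp only [hr, h, pow_zero, lt_irrefl] at this

theorem heptaLine_isLine : heptaLine.IsLine := by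
  have hs := heptaShift_eq
  refine ⟨fun k k' h => ?_, fun k => ⟨?_, ?_⟩⟩
  · obtain ⟨j, hj⟩ := heptaTile_eq_iff.1 h
    have hj : heptaShift ^ k' = heptaShift ^ k * heptaRot ^ (j : ℕ) := hj
    -- Equal cells differ by a rotation of order dividing `7`, which would make the shift of finite
    -- order.
    have h7 : heptaShift ^ ((k' - k) * 7) = 1 := by
      have : heptaShift ^ (k' - k) = heptaRot ^ (j : ℕ) := by
        rw [sub_eq_neg_add, zpow_add, hj, zpow_neg, inv_mul_cancel_left]
      rw [zpow_mul, this, show (7 : ℤ) = (7 : ℕ) from rfl, zpow_natCast, ← pow_mul, mul_comm, pow_mul, heptaRot_pow_seven, one_pow]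
    have hinj := injective_zpow_iff_not_isOfFinOrder.2 not_isOfFinOrder_heptaShift
    have := hinj (h7.trans (zpow_zero heptaShift).symm)
    omega
  -- The shift is also `b a⁴`, because `a⁻³ = a⁴`.
  · refine heptaTile_eq_iff.2 ⟨4, ?_⟩
    change heptaShift ^ (k + 1) = heptaShift ^ k * heptaRot ^ 0 * heptaHalf * heptaRot ^ 4
    have hb : heptaHalf⁻¹ = heptaHalf := inv_eq_of_mul_eq_one_left heptaHalf_mul_self
    have ha : (heptaRot ^ 3)⁻¹ = heptaRot ^ 4 :=
      inv_eq_of_mul_eq_one_left (by rw [← pow_add, heptaRot_pow_seven])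
    have hs' : heptaShift = heptaHalf * heptaRot ^ 4 := by rw [hs, mul_inv_rev, hb, ha]
    rw [zpow_add_one, pow_zero, mul_one, mul_assoc]
    exact congrArg (heptaShift ^ k * ·) hs'
  · refine heptaTile_eq_iff.2 ⟨0, ?_⟩
    change heptaShift ^ (k - 1) = heptaShift ^ k * heptaRot ^ 3 * heptaHalf * heptaRot ^ 0
    rw [zpow_sub_one, pow_zero, mul_one, mul_assoc (heptaShift ^ k), hs, inv_inv]

/-! ### Heights above the guideline, modulo `13` -/

theorem heptaRoot : (10 : ZMod 13) ^ 3 + 10 ^ 2 - 2 * 10 - 1 = 0 := by decide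

/-- The pairing of a covector with the centre of the base heptagon. -/
def centreValue (p : ZMod 13 × ZMod 13 × ZMod 13) : ZMod 13 := p.1 + 6 * p.2.1 + 9 * p.2.2

/-- The covector of the guideline, modulo `13`. -/
def guideCovector : ZMod 13 × ZMod 13 × ZMod 13 := (1, 11, 0)

/-- The image modulo `13` of the signed height, above the guideline, of the centre of a tile. -/
noncomputable def heptaHeight (g : TriangleGroup) : ZMod 13 :=
  centreValue (covAct heptaRoot guideCovector g)

/-- The coefficients `1, 6, 9` of `centreValue` are those of a vector fixed by the rotation modulo
`13`; this makes the height a function of the tile alone. -/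
theorem centreValue_covRot (p : ZMod 13 × ZMod 13 × ZMod 13) :
    centreValue (covRot 10 p) = centreValue p := by
  have h : (13 : ZMod 13) = 0 := by decide
  obtain ⟨x, y, z⟩ := p
  rw [covRot_apply]
  simp only [centreValue]
  linear_combination x * h

theorem heptaHeight_mul_rot_pow (g : TriangleGroup) (i : ℕ) :
    heptaHeight (g * heptaRot ^ i) = heptaHeight g := by
  rw [heptaHeight, covAct_mul, covAct_rot_pow]
  induction i with
  | zero => rfl
  | succ i ih => rw [Function.iterate_succ_apply', centreValue_covRot, ih]

theorem heptaHeight_eq_of_tile_eq {g h : TriangleGroup}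
    (e : heptagrid.tile g = heptagrid.tile h) : heptaHeight g = heptaHeight h := by
  obtain ⟨j, rfl⟩ := heptaTile_eq_iff.1 e
  rw [heptaHeight_mul_rot_pow]

theorem covAct_shift_zpow (k : ℤ) :
    covAct heptaRoot guideCovector (heptaShift ^ k) = guideCovector := by
  have h : covAct heptaRoot guideCovector (heptaRot ^ 3 * heptaHalf) = guideCovector := by
    rw [covAct_mul, covAct_rot_pow, covAct_half]
    decide
  rw [heptaShift_eq, inv_zpow, ← zpow_neg]
  exact covAct_zpow _ h _

/-- The numbers of the sides through which the cells of the line see a red cell. -/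
def heptaRedSides : Finset (Fin 7) := {1, 2, 5}

/-- The height of the tile seen through the side `i` by a tile with covector `p`. -/
def nbrValue (p : ZMod 13 × ZMod 13 × ZMod 13) (i : Fin 7) : ZMod 13 :=
  centreValue (covHalf 10 ((covRot 10)^[i] p))

theorem heptaHeight_nbr (g : TriangleGroup) (i : Fin 7) :
    heptaHeight (g * heptaRot ^ (i : ℕ) * heptaHalf) =
      nbrValue (covAct heptaRoot guideCovector g) i := by
  rw [heptaHeight, covAct_mul, covAct_mul, covAct_half, covAct_rot_pow]
  rfl

theorem heptaHeight_line_nbr (k : ℤ) (i : Fin 7) :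
    heptaHeight (heptaShift ^ k * heptaRot ^ (i : ℕ) * heptaHalf) = nbrValue guideCovector i := by
  rw [heptaHeight_nbr, covAct_shift_zpow]

theorem heptaHeight_line (k : ℤ) : heptaHeight (heptaShift ^ k) = centreValue guideCovector := by
  rw [heptaHeight, covAct_shift_zpow]

/-- The height `a` is the height of a cell of the line or of a red cell. -/
def IsMarkedHeight (a : ZMod 13) : Prop :=
  a = centreValue guideCovector ∨ ∃ d ∈ heptaRedSides, a = nbrValue guideCovector d

instance (a : ZMod 13) : Decidable (IsMarkedHeight a) :=
  inferInstanceAs (Decidable (_ ∨ _))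

/-- Only this direction holds in general and is needed: an unmarked height excludes line and red
cells. -/
theorem isMarkedHeight_of_mem {g : TriangleGroup}
    (h : heptagrid.tile g ∈ heptaLine.red heptaRedSides ∨
      heptagrid.tile g ∈ Set.range heptaLine.cell) : IsMarkedHeight (heptaHeight g) := by
  rcases h with ⟨k, d, hd, h⟩ | ⟨k, h⟩
  · refine Or.inr ⟨d, hd, ?_⟩
    rw [← heptaHeight_line_nbr k d]
    exact (heptaHeight_eq_of_tile_eq h).symm
  · refine Or.inl ?_
    rw [← heptaHeight_line k]
    exact (heptaHeight_eq_of_tile_eq h).symm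

/-- Modulo `13`, the line has height `2`, the neighbours through `1` and `2` have height `-2`,
through `5` height `9`, through `4` and `6` height `3`. -/
theorem heptaLine_nbr_heights : ∀ i : Fin 7, i ≠ 3 → i ≠ 0 →
    nbrValue guideCovector i ≠ centreValue guideCovector ∧
    ((∃ d ∈ heptaRedSides, nbrValue guideCovector i = nbrValue guideCovector d) →
      i ∈ heptaRedSides) := by
  decide

/-- The covector is that of a frame whose side `5` leads to a line cell, entered back through its
side `j`. -/
theorem not_marked_from_line : ∀ j : Fin 7, ∃ i ∈ heptaRedSides, ¬ IsMarkedHeight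
    (nbrValue ((covRot 10)^[2] (covHalf 10 ((covRot 10)^[j] guideCovector))) i) := by
  decide

/-- Here the side `5` of the frame leads to the red cell seen through the side `d` of a line cell.
The surviving case `d = 5`, `j = 0` is the return to that line cell. -/
theorem marked_from_red : ∀ d ∈ heptaRedSides, ∀ j : Fin 7,
    (∀ i ∈ heptaRedSides, IsMarkedHeight (nbrValue ((covRot 10)^[2] (covHalf 10 ((covRot 10)^[j]
      (covHalf 10 ((covRot 10)^[d] guideCovector))))) i)) → d = 5 ∧ j = 0 := by
  decide

theorem heptaLine_patternCharacterizes : heptaLine.PatternCharacterizes heptaRedSides := by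
  have hends : ∀ i ∈ heptaRedSides, i ≠ 3 ∧ i ≠ 0 := by decide
  intro n _ hn x F
  constructor
  · intro h
    have hmem : ∀ i ∈ heptaRedSides, heptagrid.nbr F i ∈ heptaLine.red heptaRedSides ∨
        heptagrid.nbr F i ∈ Set.range heptaLine.cell := fun i hi =>
      h.mem_red_or_mem_range hn (hends i hi).1 (hends i hi).2 hi
    clear h
    change TriangleGroup at F
    have hmark : ∀ i ∈ heptaRedSides,
        IsMarkedHeight (nbrValue (covAct heptaRoot guideCovector F) i) := fun i hi => by
      rw [← heptaHeight_nbr]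
      exact isMarkedHeight_of_mem (hmem i hi)
    -- Since `b² = 1` and `a⁵ a² = 1`, the frame is recovered from its neighbour through the side
    -- `5`.
    have hsolve : ∀ u : TriangleGroup, F * heptaRot ^ 5 * heptaHalf = u →
        F = u * heptaHalf * heptaRot ^ 2 := by
      rintro _ rfl
      rw [mul_assoc _ heptaHalf heptaHalf, heptaHalf_mul_self, mul_one, mul_assoc, ← pow_add,
        heptaRot_pow_seven, mul_one]
    rcases hmem 5 (by decide) with ⟨k, d, hd, h⟩ | ⟨k, h⟩
    · obtain ⟨j, hj⟩ := heptaTile_eq_iff.1 h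
      have hF := hsolve _ hj
      have hF : F = heptaShift ^ k * heptaRot ^ (d : ℕ) * heptaHalf * heptaRot ^ (j : ℕ) *
        heptaHalf * heptaRot ^ 2 := hF
      have hcov : covAct heptaRoot guideCovector F = (covRot 10)^[2] (covHalf 10
          ((covRot 10)^[j] (covHalf 10 ((covRot 10)^[d] guideCovector)))) := by
        rw [hF]
        simp only [covAct_mul, covAct_half, covAct_rot_pow, covAct_shift_zpow]
      rw [hcov] at hmark
      obtain ⟨rfl, rfl⟩ := marked_from_red d hd j hmark
      refine ⟨k, hF.trans ?_⟩
      change heptaShift ^ k * heptaRot ^ 5 * heptaHalf * heptaRot ^ 0 * heptaHalf *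
        heptaRot ^ 2 = heptaShift ^ k
      rw [pow_zero, mul_one, mul_assoc _ heptaHalf heptaHalf, heptaHalf_mul_self, mul_one, mul_assoc,
        ← pow_add, heptaRot_pow_seven, mul_one]
    · obtain ⟨j, hj⟩ := heptaTile_eq_iff.1 h
      have hF : F = heptaShift ^ k * heptaRot ^ (j : ℕ) * heptaHalf * heptaRot ^ 2 :=
        hsolve _ hj
      have hcov : covAct heptaRoot guideCovector F = (covRot 10)^[2] (covHalf 10
          ((covRot 10)^[j] guideCovector)) := by
        rw [hF]
        simp only [covAct_mul, covAct_half, covAct_rot_pow, covAct_shift_zpow]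
      rw [hcov] at hmark
      obtain ⟨i, hi, hi'⟩ := not_marked_from_line j
      exact (hi' (hmark i hi)).elim
  · rintro ⟨k, rfl⟩
    refine TileLine.seesPattern_frame (fun k i hi hi' => ⟨?_, ?_⟩) x k
    · rintro ⟨k', h⟩
      have e := heptaHeight_eq_of_tile_eq h
      rw [show heptaHeight (heptaLine.frame k') = _ from heptaHeight_line k'] at e
      exact (heptaLine_nbr_heights i hi hi').1 ((heptaHeight_line_nbr k i).symm.trans e.symm)
    · rintro ⟨k', d, hd, h⟩
      have e := heptaHeight_eq_of_tile_eq h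
      exact (heptaLine_nbr_heights i hi hi').2 ⟨d, hd, (heptaHeight_line_nbr k i).symm.trans
        (e.symm.trans (heptaHeight_line_nbr k' d))⟩

/-! ### The main theorem. -/

theorem theorem3 :
    -- the heptagrid
    (heptaLine.IsLine ∧
      ∃ D : Finset (Fin 7), heptaLine.left ∉ D ∧ heptaLine.right ∉ D ∧
        heptaLine.PatternCharacterizes D ∧
        ∃ f : ℕ × List (List ℕ) → List (List ℕ), heptaLine.IsSimulationAlgorithm D f) ∧
    -- the dodecagrid
    (dodecaLine.IsLine ∧
      (∀ k : ℤ, (dodecaLine.redNeighbours dodecaRedFaces (dodecaLine.frame k)).ncard = 4) ∧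
      (∀ F : dodecagrid.Frame, dodecagrid.tile F ∉ Set.range dodecaLine.cell →
        (dodecaLine.redNeighbours dodecaRedFaces F).ncard ≤ 2) ∧
      dodecaLine.PatternCharacterizes dodecaRedFaces ∧
      ∃ f : ℕ × List (List ℕ) → List (List ℕ),
        dodecaLine.IsSimulationAlgorithm dodecaRedFaces f) := by
  refine ⟨⟨heptaLine_isLine, heptaRedSides, by decide, by decide, heptaLine_patternCharacterizes,
    _, TileLine.isSimulationAlgorithm_liftTable heptagrid_regular heptaLine_isLine
      heptaLine_patternCharacterizes⟩,
    dodecaLine_isLine, dodecaLine_ncard_redNeighbours, dodecaLine_ncard_redNeighbours_le,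
    dodecaLine_patternCharacterizes, _,
    TileLine.isSimulationAlgorithm_liftTable dodecagrid_regular dodecaLine_isLine
      dodecaLine_patternCharacterizes⟩
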